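/- Let $(M,g)$ be a smooth Lorentzian manifold of dimension $n\ge 3$, let $h:M\to(0,\infty)$ be smooth and let $\Lambda\in\mathbb{R}$. Suppose that $(M,g,h\,dvol_g)$ is an isotropic solution of the vacuum weighted Einstein field equation, that is, $$h\,\rho-\operatorname{Hes}_h+(\Delta h+\Lambda)\,g=0,$$ and $\nabla h$ is lightlike at every point ($g(\nabla h,\nabla h)=0$, $\nabla h\neq 0$). Here $\rho$ is the Ricci tensor, $\operatorname{Ric}$ the Ricci operator, $\rho(X,Y)=g(\operatorname{Ric}X,Y)$, $\operatorname{Hes}_h(X,Y)=g(\nabla_X\nabla h,Y)$ and $\Delta h=\operatorname{tr}(X\mapsto\nabla_X\nabla h)$. We say that $\operatorname{Ric}$ is $k$-step nilpotent if, as a field of endomorphisms of $TM$, $\operatorname{Ric}^k$ vanishes identically and $\operatorname{Ric}^{k-1}$ does not. Then one of the following holds: 1. $(M,g)$ is Ricci-flat and $\operatorname{Hes}_h=0$. 2. $\operatorname{Ric}$ is $2$-step nilpotent and $(M,g)$ is a Brinkmann wave, i.e. it admits a parallel lightlike line field: a smooth line subbundle $L\subset TM$, spanned near each point by a smooth lightlike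 vector field $V$ with $\nabla_X V\in L$ for all $X$. 3. $\operatorname{Ric}$ is $3$-step nilpotent and $(M,g)$ is a Kundt spacetime, i.e. it admits a smooth lightlike vector field $V$ which is geodesic, $\nabla_VV=0$, and whose expansion, shear and twist $$\theta=\tfrac{1}{n-2}\nabla_iV^i,\qquad \sigma^2=(\nabla^iV^j)\nabla_{(i}V_{j)}-(n-2)\theta^2,\qquad \omega^2=(\nabla^iV^j)\nabla_{[i}V_{j]}$$ all vanish identically; moreover $V=\nabla h$ is such a vector field. -/

import Mathlib

set_option maxSynthPendingDepth 3

open scoped Manifold ContDiff Topology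

noncomputable section

/-! ## Tensor calculus of a metric `G` on a vector space of coordinates

`G : E → (E →L[ℝ] E →L[ℝ] ℝ)` is the coordinate expression of a pseudo-Riemannian metric.
Throughout, `(G x).inverse` raises an index: it is the inverse of the isomorphism
`v ↦ G x v ·` from vectors to covectors. -/

namespace Coord

variable {E : Type*} [NormedAddCommGroup E] [NormedSpace ℝ E]

/-- The Christoffel symbols of the first kind,
`(u, v, w) ↦ ½ (∂_u G(v, w) + ∂_v G(u, w) - ∂_w G(u, v))`. -/
def christoffelLower (G : E → E →L[ℝ] E →L[ℝ] ℝ) (x : E) : E →L[ℝ] E →L[ℝ] E →L[ℝ] ℝ :=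
  let D : E →L[ℝ] E →L[ℝ] E →L[ℝ] ℝ := fderiv ℝ G x
  let D' : E →L[ℝ] E →L[ℝ] E →L[ℝ] ℝ :=
    (ContinuousLinearMap.flipₗᵢ ℝ E E ℝ).toContinuousLinearEquiv.toContinuousLinearMap.comp D.flip
  (1 / 2 : ℝ) • (D + D.flip - D')

theorem christoffelLower_apply (G : E → E →L[ℝ] E →L[ℝ] ℝ) (x u v w : E) :
    christoffelLower G x u v w =
      1 / 2 * (fderiv ℝ G x u v w + fderiv ℝ G x v u w - fderiv ℝ G x w u v) := by
  simp [christoffelLower]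

/-- The Christoffel symbols `Γ(u, v)` of the Levi-Civita connection. -/
def christoffel (G : E → E →L[ℝ] E →L[ℝ] ℝ) (x : E) : E →L[ℝ] E →L[ℝ] E :=
  (ContinuousLinearMap.compL ℝ E (E →L[ℝ] ℝ) E (G x).inverse).comp (christoffelLower G x)

theorem christoffel_apply (G : E → E →L[ℝ] E →L[ℝ] ℝ) (x u v : E) :
    christoffel G x u v = (G x).inverse (christoffelLower G x u v) := rfl

/-- The covariant derivative `u ↦ ∇_u V = ∂_u V + Γ(u, V)` of a vector field at `x`. -/
def covDeriv (G : E → E →L[ℝ] E →L[ℝ] ℝ) (V : E → E) (x : E) : E →L[ℝ] E :=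
  fderiv ℝ V x + (christoffel G x).flip (V x)

/-- The endomorphism `u ↦ R(u, v) w`, where
`R(u, v) = ∇_u ∇_v - ∇_v ∇_u - ∇_[u,v]` is the curvature tensor. -/
def curvature (G : E → E →L[ℝ] E →L[ℝ] ℝ) (x v w : E) : E →L[ℝ] E :=
  ((fderiv ℝ (christoffel G) x).flip v).flip w - (fderiv ℝ (christoffel G) x v).flip w
    + (christoffel G x).flip (christoffel G x v w)
    - (christoffel G x v).comp ((christoffel G x).flip w)

theorem curvature_apply (G : E → E →L[ℝ] E →L[ℝ] ℝ) (x u v w : E) :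
    curvature G x v w u =
      fderiv ℝ (christoffel G) x u v w - fderiv ℝ (christoffel G) x v u w
        + christoffel G x u (christoffel G x v w)
        - christoffel G x v (christoffel G x u w) := rfl

/-- The Ricci tensor `(v, w) ↦ tr (u ↦ R(u, v) w)`. -/
def ricci [FiniteDimensional ℝ E] (G : E → E →L[ℝ] E →L[ℝ] ℝ) (x : E) : E →L[ℝ] E →L[ℝ] ℝ :=
  (LinearMap.mk₂ ℝ
    (fun v w => LinearMap.trace ℝ E (curvature G x v w : E →ₗ[ℝ] E))
    (fun v v' w => by
      rw [← map_add]; congr 1; ext u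
      simp [curvature_apply]; abel)
    (fun c v w => by
      rw [← map_smul]; congr 1; ext u
      simp [curvature_apply, smul_add, smul_sub])
    (fun v w w' => by
      rw [← map_add]; congr 1; ext u
      simp [curvature_apply]; abel)
    (fun c v w => by
      rw [← map_smul]; congr 1; ext u
      simp [curvature_apply, smul_add, smul_sub])).toContinuousBilinearMap

theorem ricci_apply [FiniteDimensional ℝ E] (G : E → E →L[ℝ] E →L[ℝ] ℝ) (x v w : E) :
    ricci G x v w = LinearMap.trace ℝ E (curvature G x v w : E →ₗ[ℝ] E) := rfl

end Coord

/-- A smooth Lorentzian metric on a manifold `M`: a smooth field of symmetric bilinear forms of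
signature `(-, +, …, +)`, that is, at each point there is a timelike vector and the form is
positive definite on its orthogonal complement. -/
structure LorentzMetric (E : Type*) [NormedAddCommGroup E] [NormedSpace ℝ E]
    (M : Type*) [TopologicalSpace M] [ChartedSpace E M] [IsManifold 𝓘(ℝ, E) ∞ M] where
  /-- the scalar product of each tangent space -/
  val (p : M) : TangentSpace 𝓘(ℝ, E) p →L[ℝ] TangentSpace 𝓘(ℝ, E) p →L[ℝ] ℝ
  symm (p : M) (u v : TangentSpace 𝓘(ℝ, E) p) : val p u v = val p v u
  lorentzian (p : M) : ∃ t : TangentSpace 𝓘(ℝ, E) p, val p t t < 0 ∧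
    ∀ v : TangentSpace 𝓘(ℝ, E) p, val p t v = 0 → v ≠ 0 → 0 < val p v v
  contMDiff : ContMDiff 𝓘(ℝ, E) (𝓘(ℝ, E).prod 𝓘(ℝ, E →L[ℝ] E →L[ℝ] ℝ)) ∞
    (fun p => Bundle.TotalSpace.mk' (E →L[ℝ] E →L[ℝ] ℝ)
      (E := fun p : M => TangentSpace 𝓘(ℝ, E) p →L[ℝ] TangentSpace 𝓘(ℝ, E) p →L[ℝ] ℝ) p (val p))

namespace LorentzMetric

variable {E : Type*} [NormedAddCommGroup E] [NormedSpace ℝ E]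
  {M : Type*} [TopologicalSpace M] [ChartedSpace E M] [IsManifold 𝓘(ℝ, E) ∞ M]
  (g : LorentzMetric E M)

/-- The coordinate expression of the metric in the preferred chart at `p`. -/
def coord (p : M) (y : E) : E →L[ℝ] E →L[ℝ] ℝ :=
  let B : E →L[ℝ] E →L[ℝ] ℝ := g.val ((extChartAt 𝓘(ℝ, E) p).symm y)
  let A : E →L[ℝ] E := mfderiv 𝓘(ℝ, E) 𝓘(ℝ, E) (extChartAt 𝓘(ℝ, E) p).symm y
  B.bilinearComp A A

/-- The Levi-Civita covariant derivative `u ↦ ∇_u V` of a vector field `V` at `p`. It is computed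
in the preferred chart at `p`, whose coordinate frame at `p` is the one by which Mathlib identifies
`T_p M` with `E`. -/
def nabla (V : ∀ p : M, TangentSpace 𝓘(ℝ, E) p) (p : M) :
    TangentSpace 𝓘(ℝ, E) p →L[ℝ] TangentSpace 𝓘(ℝ, E) p :=
  (Coord.covDeriv (g.coord p)
    (VectorField.mpullback 𝓘(ℝ, E) 𝓘(ℝ, E) (extChartAt 𝓘(ℝ, E) p).symm V)
    (extChartAt 𝓘(ℝ, E) p p) : E →L[ℝ] E)

/-- The Ricci tensor `ρ` at `p`. -/
def ricci [FiniteDimensional ℝ E] (p : M) :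
    TangentSpace 𝓘(ℝ, E) p →L[ℝ] TangentSpace 𝓘(ℝ, E) p →L[ℝ] ℝ :=
  (Coord.ricci (g.coord p) (extChartAt 𝓘(ℝ, E) p p) : E →L[ℝ] E →L[ℝ] ℝ)

/-- The Ricci operator, determined by `ρ(X, Y) = g(Ric X, Y)`. -/
def ricciOp [FiniteDimensional ℝ E] (p : M) :
    TangentSpace 𝓘(ℝ, E) p →L[ℝ] TangentSpace 𝓘(ℝ, E) p :=
  (g.val p).inverse.comp (g.ricci p)

/-- The gradient of a function, determined by `g(∇h, X) = dh(X)`. -/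
def grad (h : M → ℝ) (p : M) : TangentSpace 𝓘(ℝ, E) p :=
  (g.val p).inverse (mfderiv 𝓘(ℝ, E) 𝓘(ℝ, ℝ) h p : TangentSpace 𝓘(ℝ, E) p →L[ℝ] ℝ)

/-- The Hessian tensor `Hes_h(X, Y) = g(∇_X ∇h, Y)`. -/
def hess (h : M → ℝ) (p : M) :
    TangentSpace 𝓘(ℝ, E) p →L[ℝ] TangentSpace 𝓘(ℝ, E) p →L[ℝ] ℝ :=
  (g.val p).comp (g.nabla (g.grad h) p)

/-- The divergence `∇_i V^i` of a vector field. -/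
def div (V : ∀ p : M, TangentSpace 𝓘(ℝ, E) p) (p : M) : ℝ :=
  LinearMap.trace ℝ (TangentSpace 𝓘(ℝ, E) p)
    (g.nabla V p : TangentSpace 𝓘(ℝ, E) p →ₗ[ℝ] TangentSpace 𝓘(ℝ, E) p)

/-- The Laplacian `Δh = div ∇h`. -/
def laplacian (h : M → ℝ) (p : M) : ℝ := g.div (g.grad h) p

/-- Lightlike vectors: nonzero null vectors. -/
def IsLightlike (p : M) (v : TangentSpace 𝓘(ℝ, E) p) : Prop := v ≠ 0 ∧ g.val p v v = 0

/-- The vacuum weighted Einstein field equation `h ρ - Hes_h + (Δh + Λ) g = 0` for a positive smooth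
density `h`, with lightlike gradient `∇h`. -/
structure IsIsotropicSolution [FiniteDimensional ℝ E] (h : M → ℝ) (Λ : ℝ) : Prop where
  smooth : ContMDiff 𝓘(ℝ, E) 𝓘(ℝ, ℝ) ∞ h
  pos : ∀ p, 0 < h p
  equation : ∀ p, h p • g.ricci p - g.hess h p + (g.laplacian h p + Λ) • g.val p = 0
  lightlike : ∀ p, g.IsLightlike p (g.grad h p)

/-- The adjoint of an endomorphism `A` of `T_p M`: `g(A* u, w) = g(u, A w)`. -/
def adjoint (p : M) (A : TangentSpace 𝓘(ℝ, E) p →L[ℝ] TangentSpace 𝓘(ℝ, E) p) :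
    TangentSpace 𝓘(ℝ, E) p →ₗ[ℝ] TangentSpace 𝓘(ℝ, E) p where
  toFun u := (g.val p).inverse ((g.val p u).comp A)
  map_add' u v := by simp [ContinuousLinearMap.add_comp]
  map_smul' c u := by simp [ContinuousLinearMap.smul_comp]

/-- The full contraction `a^{ij} b_{ij}` of the tensors `a_{ij} = g(A e_i, e_j)` and
`b_{ij} = g(B e_i, e_j)`; it is the trace of `A* B`. -/
def contract (p : M) (A : TangentSpace 𝓘(ℝ, E) p →L[ℝ] TangentSpace 𝓘(ℝ, E) p)
    (B : TangentSpace 𝓘(ℝ, E) p →ₗ[ℝ] TangentSpace 𝓘(ℝ, E) p) : ℝ :=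
  LinearMap.trace ℝ (TangentSpace 𝓘(ℝ, E) p) (g.adjoint p A ∘ₗ B)

/-- The expansion `θ = (n - 2)⁻¹ ∇_i V^i`. -/
def expansion (V : ∀ p : M, TangentSpace 𝓘(ℝ, E) p) (p : M) : ℝ :=
  1 / ((Module.finrank ℝ E : ℝ) - 2) * g.div V p

/-- The squared shear `σ² = (∇^i V^j) ∇_{(i} V_{j)} - (n - 2) θ²`. -/
def shearSq (V : ∀ p : M, TangentSpace 𝓘(ℝ, E) p) (p : M) : ℝ :=
  g.contract p (g.nabla V p) ((1 / 2 : ℝ) • (↑(g.nabla V p) + g.adjoint p (g.nabla V p)))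
    - ((Module.finrank ℝ E : ℝ) - 2) * g.expansion V p ^ 2

/-- The squared twist `ω² = (∇^i V^j) ∇_{[i} V_{j]}`. -/
def twistSq (V : ∀ p : M, TangentSpace 𝓘(ℝ, E) p) (p : M) : ℝ :=
  g.contract p (g.nabla V p) ((1 / 2 : ℝ) • (↑(g.nabla V p) - g.adjoint p (g.nabla V p)))

/-- Smoothness of a vector field on a set. -/
def SmoothOn (V : ∀ p : M, TangentSpace 𝓘(ℝ, E) p) (U : Set M) : Prop :=
  ContMDiffOn 𝓘(ℝ, E) (𝓘(ℝ, E).prod 𝓘(ℝ, E)) ∞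
    (fun p => (⟨p, V p⟩ : TangentBundle 𝓘(ℝ, E) M)) U

/-- `V` is a smooth lightlike geodesic vector field with zero optical scalars. -/
structure IsKundtField (V : ∀ p : M, TangentSpace 𝓘(ℝ, E) p) : Prop where
  smooth : SmoothOn V Set.univ
  lightlike : ∀ p, g.IsLightlike p (V p)
  geodesic : ∀ p, g.nabla V p (V p) = 0
  expansion_free : ∀ p, g.expansion V p = 0
  shear_free : ∀ p, g.shearSq V p = 0
  twist_free : ∀ p, g.twistSq V p = 0

/-- A Kundt spacetime: there is a lightlike geodesic vector field with zero optical scalars. -/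
def IsKundt : Prop := ∃ V : ∀ p : M, TangentSpace 𝓘(ℝ, E) p, g.IsKundtField V

/-- A Brinkmann wave: there is a parallel lightlike line field `L`. Near each point `L` is spanned by
a smooth lightlike vector field `V` with `∇_u V ∈ L` for all tangent vectors `u`. -/
def IsBrinkmannWave : Prop :=
  ∃ L : ∀ p : M, Submodule ℝ (TangentSpace 𝓘(ℝ, E) p),
    ∀ p : M, ∃ U : Set M, IsOpen U ∧ p ∈ U ∧
      ∃ V : ∀ q : M, TangentSpace 𝓘(ℝ, E) q, SmoothOn V U ∧
        ∀ q ∈ U, g.IsLightlike q (V q) ∧ L q = Submodule.span ℝ {V q} ∧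
          ∀ u : TangentSpace 𝓘(ℝ, E) q, g.nabla V q u ∈ L q

/-- The Ricci operator is `k`-step nilpotent, as an endomorphism of the tangent bundle: its `k`-th
power is the zero tensor field and its `(k - 1)`-st power is not. -/
def RicciStepNilpotent [FiniteDimensional ℝ E] (k : ℕ) : Prop :=
  (∀ p, g.ricciOp p ^ k = 0) ∧ ∃ p, g.ricciOp p ^ (k - 1) ≠ 0

end LorentzMetric

end

/-! Write U = ∇h and A = ∇U. Then A is self-adjoint, and differentiating g(U, U) = 0 gives AU = 0.
The equation reads h Ric = A - (tr A + Λ) Id, so ρ(U, U) = 0.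

The analytic core is tr A² = 0 (`traceL_hessOp_sq_of_normal`). In the divergence of the equation the
term Ric(U) from div(h Ric) cancels against the curvature term of the Ricci identity for div A, so
div Ric = 0 and, by the contracted Bianchi identity, the scalar curvature τ has dτ = 0. The trace of
the differentiated equation then says τ dh = (1 - n) d(tr A), so tr A is constant along U. Finally
the Ricci identity (∇_a A)U = (∇_U A)a + R(a, U)U has left side -A²a because AU = 0; its trace is tr
A² = 0.

The rest is linear algebra (`lorentz_selfAdjoint`). On the Euclidean quotient U^⊥/ℝU the map A
induces a self-adjoint endomorphism whose square is traceless, hence zero. So A maps U^⊥ into ℝU, tr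
A = 0 and A³ = 0; if moreover A² = 0, the image of A consists of null vectors of U^⊥, that is, of
multiples of U. Since tr A vanishes identically, τ dh = 0 while hτ = -nΛ, which forces Λ = 0 and h
Ric = A. The three alternatives are A ≡ 0; A ≢ 0 with A² ≡ 0, when U spans a parallel line field;
and A² ≢ 0. The Kundt conditions on U hold in every case, being AU = 0, tr A = 0, tr A² = 0 and A =
A*.

Curvature identities are checked at a point where the Christoffel symbols vanish. Naturality under
`IsPullback` carries the result back to an arbitrary chart, and also relates the preferred charts of
different points, in which the tensors on M are defined. -/

noncomputable section

namespace Coord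

variable {E : Type*} [NormedAddCommGroup E] [NormedSpace ℝ E]

/-! ### Differentiation rules for fields of linear maps -/

section Calculus

variable {F F' : Type*} [NormedAddCommGroup F] [NormedSpace ℝ F]
  [NormedAddCommGroup F'] [NormedSpace ℝ F']

theorem fderiv_apply_apply {A : E → F →L[ℝ] F'} {V : E → F} {x : E}
    (hA : DifferentiableAt ℝ A x) (hV : DifferentiableAt ℝ V x) (u : E) :
    fderiv ℝ (fun y => A y (V y)) x u = fderiv ℝ A x u (V x) + A x (fderiv ℝ V x u) := by
  rw [fderiv_clm_apply hA hV]
  simp [add_comm]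

theorem fderiv_apply_const {A : E → F →L[ℝ] F'} {x : E}
    (hA : DifferentiableAt ℝ A x) (u : E) (v : F) :
    fderiv ℝ (fun y => A y v) x u = fderiv ℝ A x u v := by
  rw [fderiv_apply_apply hA (differentiableAt_const v)]
  simp

theorem fderiv_comp_apply {A : F → F'} {f : E → F} {x : E}
    (hA : DifferentiableAt ℝ A (f x)) (hf : DifferentiableAt ℝ f x) (u : E) :
    fderiv ℝ (fun y => A (f y)) x u = fderiv ℝ A (f x) (fderiv ℝ f x u) := by
  have := fderiv_comp (𝕜 := ℝ) x hA hf
  simp only [Function.comp_def] at this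
  rw [this]; rfl

end Calculus

section Smooth

variable {F F' : Type*} [NormedAddCommGroup F] [NormedSpace ℝ F]
  [NormedAddCommGroup F'] [NormedSpace ℝ F']

theorem _root_.ContDiffAt.fderiv_infty {f : E → F} {x : E} (hf : ContDiffAt ℝ ∞ f x) :
    ContDiffAt ℝ ∞ (fderiv ℝ f) x :=
  hf.fderiv_right (by norm_cast)

theorem _root_.ContDiffAt.differentiableAt_infty {f : E → F} {x : E} (hf : ContDiffAt ℝ ∞ f x) :
    DifferentiableAt ℝ f x :=
  hf.differentiableAt (by simp)

theorem _root_.ContDiffAt.symm_infty {f : E → F} {x : E} (hf : ContDiffAt ℝ ∞ f x) (u v : E) :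
    fderiv ℝ (fderiv ℝ f) x u v = fderiv ℝ (fderiv ℝ f) x v u :=
  hf.isSymmSndFDerivAt (by simpa using (mod_cast le_top : (((2 : ℕ∞) : WithTop ℕ∞)) ≤ ∞)) u v

end Smooth

/-! ### Levi-Civita calculus of a coordinate metric -/

/-- On the open set `S`, the field `G` is a smooth field of symmetric nondegenerate forms. -/
structure IsMetricOn (G : E → E →L[ℝ] E →L[ℝ] ℝ) (S : Set E) : Prop where
  isOpen : IsOpen S
  smooth : ∀ y ∈ S, ContDiffAt ℝ ∞ G y
  symm : ∀ y ∈ S, ∀ u v, G y u v = G y v u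
  invertible : ∀ y ∈ S, (G y).IsInvertible

namespace IsMetricOn

variable {G : E → E →L[ℝ] E →L[ℝ] ℝ} {S : Set E} {x : E}

theorem eventually (hG : IsMetricOn G S) (hx : x ∈ S) : ∀ᶠ y in 𝓝 x, y ∈ S :=
  hG.isOpen.mem_nhds hx

theorem apply_inverse (hG : IsMetricOn G S) (hx : x ∈ S) (l : E →L[ℝ] ℝ) :
    G x ((G x).inverse l) = l := by
  obtain ⟨e, he⟩ := hG.invertible x hx
  rw [← he]; simp

theorem inverse_apply (hG : IsMetricOn G S) (hx : x ∈ S) (v : E) :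
    (G x).inverse (G x v) = v := by
  obtain ⟨e, he⟩ := hG.invertible x hx
  rw [← he]; simp

theorem eq_of_apply_eq (hG : IsMetricOn G S) (hx : x ∈ S) {u v : E}
    (h : ∀ w, G x u w = G x v w) : u = v := by
  rw [← hG.inverse_apply hx u, ← hG.inverse_apply hx v]
  congr 1
  ext w; exact h w

theorem apply_christoffel (hG : IsMetricOn G S) (hx : x ∈ S) (u v w : E) :
    G x (christoffel G x u v) w =
      1 / 2 * (fderiv ℝ G x u v w + fderiv ℝ G x v u w - fderiv ℝ G x w u v) := by
  rw [christoffel_apply, hG.apply_inverse hx, christoffelLower_apply]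

theorem fderiv_symm (hG : IsMetricOn G S) (hx : x ∈ S) (u v w : E) :
    fderiv ℝ G x u v w = fderiv ℝ G x u w v := by
  have hd := (hG.smooth x hx).differentiableAt_infty
  have h1 : ∀ v w : E, fderiv ℝ (fun y => G y v w) x u = fderiv ℝ G x u v w := by
    intro v w
    rw [fderiv_apply_const (hd.clm_apply (differentiableAt_const v)), fderiv_apply_const hd]
  rw [← h1, ← h1]
  have : (fun y => G y v w) =ᶠ[𝓝 x] fun y => G y w v := by
    filter_upwards [hG.eventually hx] with y hy using hG.symm y hy v w
  rw [this.fderiv_eq]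

theorem christoffel_symm (hG : IsMetricOn G S) (hx : x ∈ S) (u v : E) :
    christoffel G x u v = christoffel G x v u := by
  refine hG.eq_of_apply_eq hx fun w => ?_
  rw [hG.apply_christoffel hx, hG.apply_christoffel hx, hG.fderiv_symm hx w u v]
  ring

/-- Metric compatibility, ∇G = 0: in the sum of two Koszul formulas all but one derivative cancel.
-/
theorem fderiv_eq (hG : IsMetricOn G S) (hx : x ∈ S) (u v w : E) :
    fderiv ℝ G x u v w = G x (christoffel G x u v) w + G x v (christoffel G x u w) := by
  rw [hG.symm x hx v, hG.apply_christoffel hx, hG.apply_christoffel hx,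
    hG.fderiv_symm hx u w v, hG.fderiv_symm hx w u v, hG.fderiv_symm hx v u w]
  ring

variable [FiniteDimensional ℝ E]

theorem contDiffAt_inverse (hG : IsMetricOn G S) (hx : x ∈ S) :
    ContDiffAt ℝ ∞ (fun y => (G y).inverse) x := by
  have := FiniteDimensional.complete ℝ E
  exact (hG.invertible x hx).contDiffAt_map_inverse.comp x (hG.smooth x hx)

theorem contDiffAt_christoffel (hG : IsMetricOn G S) (hx : x ∈ S) :
    ContDiffAt ℝ ∞ (christoffel G) x := by
  have hD := (hG.smooth x hx).fderiv_infty
  have hf : ContDiffAt ℝ ∞ (fun y => (fderiv ℝ G y).flip) x :=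
    (ContinuousLinearMap.flipₗᵢ ℝ E E (E →L[ℝ] ℝ)).toContinuousLinearEquiv.contDiff.contDiffAt.comp
      x hD
  have hl : ContDiffAt ℝ ∞ (christoffelLower G) x := by
    unfold christoffelLower
    exact ((hD.add hf).sub (contDiffAt_const.clm_comp hf)).const_smul _
  exact ((ContinuousLinearMap.compL ℝ E (E →L[ℝ] ℝ) E).contDiff.contDiffAt.comp x
    (hG.contDiffAt_inverse hx)).clm_comp hl

theorem contDiffAt_covDeriv (hG : IsMetricOn G S) (hx : x ∈ S) {V : E → E}
    (hV : ContDiffAt ℝ ∞ V x) : ContDiffAt ℝ ∞ (covDeriv G V) x := by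
  have hf : ContDiffAt ℝ ∞ (fun y => (christoffel G y).flip) x :=
    (ContinuousLinearMap.flipₗᵢ ℝ E E E).toContinuousLinearEquiv.contDiff.contDiffAt.comp
      x (hG.contDiffAt_christoffel hx)
  exact hV.fderiv_infty.add (hf.clm_apply hV)

theorem contDiffAt_curvature (hG : IsMetricOn G S) (hx : x ∈ S) (v w : E) :
    ContDiffAt ℝ ∞ (fun y => curvature G y v w) x := by
  have hc := hG.contDiffAt_christoffel hx
  have hd := hc.fderiv_infty
  have flip1 : ∀ {A : E → E →L[ℝ] E →L[ℝ] E →L[ℝ] E}, ContDiffAt ℝ ∞ A x →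
      ContDiffAt ℝ ∞ (fun y => (A y).flip) x := fun hA =>
    (ContinuousLinearMap.flipₗᵢ ℝ E E (E →L[ℝ] E)).toContinuousLinearEquiv.contDiff.contDiffAt.comp
      x hA
  have flip2 : ∀ {A : E → E →L[ℝ] E →L[ℝ] E}, ContDiffAt ℝ ∞ A x →
      ContDiffAt ℝ ∞ (fun y => (A y).flip) x := fun hA =>
    (ContinuousLinearMap.flipₗᵢ ℝ E E E).toContinuousLinearEquiv.contDiff.contDiffAt.comp x hA
  have k : ∀ v : E, ContDiffAt ℝ ∞ (fun _ : E => v) x := fun v => contDiffAt_const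
  unfold curvature
  exact ((((flip2 ((flip1 hd).clm_apply (k v))).clm_apply (k w)).sub
    ((flip2 (hd.clm_apply (k v))).clm_apply (k w))).add
    ((flip2 hc).clm_apply ((hc.clm_apply (k v)).clm_apply (k w)))).sub
    ((hc.clm_apply (k v)).clm_comp ((flip2 hc).clm_apply (k w)))

/-- The product rule applied to ∇G = 0. Symmetry of the second derivative in `a` and `u` will give
the skewness of the curvature. -/
theorem fderiv_fderiv_apply (hG : IsMetricOn G S) (hx : x ∈ S) (a u v w : E) :
    fderiv ℝ (fderiv ℝ G) x a u v w =
      fderiv ℝ G x a (christoffel G x u v) w + G x (fderiv ℝ (christoffel G) x a u v) w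
        + fderiv ℝ G x a v (christoffel G x u w) + G x v (fderiv ℝ (christoffel G) x a u w) := by
  have hd := (hG.smooth x hx).differentiableAt_infty
  have hd' := (hG.smooth x hx).fderiv_infty.differentiableAt_infty
  have hc := (hG.contDiffAt_christoffel hx).differentiableAt_infty
  have k : ∀ v : E, DifferentiableAt ℝ (fun _ : E => v) x := fun v => differentiableAt_const v
  have hcc : ∀ u v : E, DifferentiableAt ℝ (fun y => christoffel G y u v) x := fun u v =>
    (hc.clm_apply (k u)).clm_apply (k v)
  have hcc' : ∀ u v : E, fderiv ℝ (fun y => christoffel G y u v) x a =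
      fderiv ℝ (christoffel G) x a u v := fun u v => by
    rw [fderiv_apply_const (hc.clm_apply (k u)), fderiv_apply_const hc]
  have h1 : (fun y => fderiv ℝ G y u v w) =ᶠ[𝓝 x]
      fun y => G y (christoffel G y u v) w + G y v (christoffel G y u w) := by
    filter_upwards [hG.eventually hx] with y hy using hG.fderiv_eq hy u v w
  have h2 := congrArg (fun L : E →L[ℝ] ℝ => L a) h1.fderiv_eq
  rw [fderiv_fun_add ((hd.clm_apply (hcc u v)).clm_apply (k w))
    ((hd.clm_apply (k v)).clm_apply (hcc u w))] at h2
  simp only [add_apply] at h2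
  rw [fderiv_apply_const ((hd'.clm_apply (k u)).clm_apply (k v)),
    fderiv_apply_const (hd'.clm_apply (k u)), fderiv_apply_const hd',
    fderiv_apply_const (hd.clm_apply (hcc u v)), fderiv_apply_apply hd (hcc u v),
    fderiv_apply_apply (hd.clm_apply (k v)) (hcc u w), fderiv_apply_const hd, hcc', hcc'] at h2
  rw [h2]
  simp only [add_apply]
  ring

/-- The curvature operators are skew-adjoint. -/
theorem curvature_skew (hG : IsMetricOn G S) (hx : x ∈ S) (u v w z : E) :
    G x (curvature G x v w u) z = - G x (curvature G x v z u) w := by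
  have h1 := hG.fderiv_fderiv_apply hx u v w z
  have h2 := hG.fderiv_fderiv_apply hx v u w z
  -- The mixed second derivatives of `G` agree; once `DG` is written through Γ, their difference is
  -- the skewness identity.
  rw [(hG.smooth x hx).symm_infty u v, h2] at h1
  simp only [hG.fderiv_eq hx] at h1
  rw [hG.symm x hx w, hG.symm x hx w, hG.symm x hx w, hG.symm x hx w] at h1
  simp only [curvature_apply, map_add, map_sub, add_apply, sub_apply]
  rw [hG.symm x hx (christoffel G x u w), hG.symm x hx (christoffel G x v w)] at h1
  linarith

end IsMetricOn

/-! ### Gradient, Hessian operator and the field equation in coordinates -/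

/-- The trace as a continuous linear functional. -/
def traceL (E : Type*) [NormedAddCommGroup E] [NormedSpace ℝ E] [FiniteDimensional ℝ E] :
    (E →L[ℝ] E) →L[ℝ] ℝ :=
  LinearMap.toContinuousLinearMap
    ((LinearMap.trace ℝ E).comp (ContinuousLinearMap.coeLM ℝ))

theorem traceL_apply [FiniteDimensional ℝ E] (A : E →L[ℝ] E) :
    traceL E A = LinearMap.trace ℝ E (A : E →ₗ[ℝ] E) := rfl

theorem ricci_eq_traceL [FiniteDimensional ℝ E] (G : E → E →L[ℝ] E →L[ℝ] ℝ) (x v w : E) :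
    ricci G x v w = traceL E (curvature G x v w) := rfl

theorem covDeriv_apply (G : E → E →L[ℝ] E →L[ℝ] ℝ) (V : E → E) (x u : E) :
    covDeriv G V x u = fderiv ℝ V x u + christoffel G x u (V x) := rfl

/-- The gradient of a function. -/
def grad (G : E → E →L[ℝ] E →L[ℝ] ℝ) (h : E → ℝ) (x : E) : E :=
  (G x).inverse (fderiv ℝ h x)

/-- The Hessian operator `u ↦ ∇_u ∇h`. -/
def hessOp (G : E → E →L[ℝ] E →L[ℝ] ℝ) (h : E → ℝ) (x : E) : E →L[ℝ] E :=
  covDeriv G (grad G h) x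

/-- The equation `h ρ - Hes_h + (Δh + Λ) g = 0` at a point. -/
def EinsteinAt [FiniteDimensional ℝ E] (G : E → E →L[ℝ] E →L[ℝ] ℝ) (h : E → ℝ) (Λ : ℝ) (x : E) :
    Prop :=
  h x • ricci G x - (G x).comp (hessOp G h x) + (traceL E (hessOp G h x) + Λ) • G x = 0

namespace IsMetricOn

variable {G : E → E →L[ℝ] E →L[ℝ] ℝ} {S : Set E} {x : E}

theorem apply_grad (hG : IsMetricOn G S) (hx : x ∈ S) (h : E → ℝ) (v : E) :
    G x (grad G h x) v = fderiv ℝ h x v := by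
  rw [grad, hG.apply_inverse hx]

/-- The product rule for the Levi-Civita connection. -/
theorem fderiv_inner (hG : IsMetricOn G S) (hx : x ∈ S) {V W : E → E}
    (hV : DifferentiableAt ℝ V x) (hW : DifferentiableAt ℝ W x) (u : E) :
    fderiv ℝ (fun y => G y (V y) (W y)) x u =
      G x (covDeriv G V x u) (W x) + G x (V x) (covDeriv G W x u) := by
  have hd := (hG.smooth x hx).differentiableAt_infty
  rw [fderiv_apply_apply (hd.clm_apply hV) hW, fderiv_apply_apply hd hV,
    add_apply, hG.fderiv_eq hx, covDeriv_apply, covDeriv_apply]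
  simp only [map_add, add_apply]
  ring

variable [FiniteDimensional ℝ E]

theorem contDiffAt_grad (hG : IsMetricOn G S) (hx : x ∈ S) {h : E → ℝ} (hh : ContDiffAt ℝ ∞ h x) :
    ContDiffAt ℝ ∞ (grad G h) x :=
  (hG.contDiffAt_inverse hx).clm_apply hh.fderiv_infty

theorem contDiffAt_hessOp (hG : IsMetricOn G S) (hx : x ∈ S) {h : E → ℝ}
    (hh : ContDiffAt ℝ ∞ h x) : ContDiffAt ℝ ∞ (hessOp G h) x :=
  hG.contDiffAt_covDeriv hx (hG.contDiffAt_grad hx hh)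

/-- The product rule for g(∇h, v) with `v` a constant field, whose covariant derivative is Γ(u, v).
-/
theorem apply_hessOp (hG : IsMetricOn G S) (hx : x ∈ S) {h : E → ℝ}
    (hh : ContDiffAt ℝ ∞ h x) (u v : E) :
    G x (hessOp G h x u) v =
      fderiv ℝ (fderiv ℝ h) x u v - fderiv ℝ h x (christoffel G x u v) := by
  have h1 := hG.fderiv_inner hx (hG.contDiffAt_grad hx hh).differentiableAt_infty
    (differentiableAt_const v) u
  have h2 : (fun y => G y (grad G h y) v) =ᶠ[𝓝 x] fun y => fderiv ℝ h y v := by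
    filter_upwards [hG.eventually hx] with y hy using hG.apply_grad hy h v
  rw [h2.fderiv_eq, fderiv_apply_const hh.fderiv_infty.differentiableAt_infty,
    covDeriv_apply G (fun _ => v), hG.apply_grad hx] at h1
  simp only [fderiv_const_apply, zero_apply, zero_add] at h1
  rw [h1, hessOp]; ring

theorem hessOp_symm (hG : IsMetricOn G S) (hx : x ∈ S) {h : E → ℝ}
    (hh : ContDiffAt ℝ ∞ h x) (u v : E) :
    G x (hessOp G h x u) v = G x u (hessOp G h x v) := by
  rw [hG.symm x hx u, hG.apply_hessOp hx hh, hG.apply_hessOp hx hh, hh.symm_infty,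
    hG.christoffel_symm hx]

/-- By symmetry of the Hessian, g(∇_U U, w) = g(U, ∇_w U), which is half the derivative of g(U, U)
along `w`. -/
theorem hessOp_grad (hG : IsMetricOn G S) (hx : x ∈ S) {h : E → ℝ} (hh : ContDiffAt ℝ ∞ h x)
    (hn : ∀ᶠ y in 𝓝 x, G y (grad G h y) (grad G h y) = 0) : hessOp G h x (grad G h x) = 0 := by
  refine hG.eq_of_apply_eq hx fun w => ?_
  have hd := (hG.contDiffAt_grad hx hh).differentiableAt_infty
  have h1 := hG.fderiv_inner hx hd hd w
  have h2 : (fun y => G y (grad G h y) (grad G h y)) =ᶠ[𝓝 x] fun _ => 0 := hn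
  rw [h2.fderiv_eq, hG.symm x hx (grad G h x)] at h1
  simp only [fderiv_const_apply, zero_apply] at h1
  rw [hG.hessOp_symm hx hh, hG.symm x hx, hessOp]
  simp; linarith

end IsMetricOn

end Coord

/-! ### Naturality under local diffeomorphisms -/

namespace Coord

variable {E : Type*} [NormedAddCommGroup E] [NormedSpace ℝ E]

theorem isInvertible_of_nondegenerate [FiniteDimensional ℝ E] {B : E →L[ℝ] E →L[ℝ] ℝ}
    (hB : ∀ u, (∀ v, B u v = 0) → u = 0) : B.IsInvertible := by
  have hinj : Function.Injective (B : E →ₗ[ℝ] E →L[ℝ] ℝ) := by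
    rw [injective_iff_map_eq_zero]
    intro u hu
    exact hB u fun v => congrArg (fun L : E →L[ℝ] ℝ => L v) hu
  have hdim : Module.finrank ℝ E = Module.finrank ℝ (E →L[ℝ] ℝ) := by
    rw [← (LinearMap.toContinuousLinearMap (𝕜 := ℝ) (E := E) (F' := ℝ)).finrank_eq]
    exact Subspace.dual_finrank_eq.symm
  exact ⟨(LinearMap.linearEquivOfInjective _ hinj hdim).toContinuousLinearEquiv, by ext u v; rfl⟩

theorem contDiffAt_bilinear_of_apply {G : E → E →L[ℝ] E →L[ℝ] ℝ} [FiniteDimensional ℝ E]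
    {S : Set E} (hS : IsOpen S)
    (h : ∀ u v, ContDiffOn ℝ ∞ (fun y => G y u v) S) {x : E} (hx : x ∈ S) :
    ContDiffAt ℝ ∞ G x :=
  (contDiffOn_clm_apply.2 fun u => contDiffOn_clm_apply.2 fun v => h u v).contDiffAt
    (hS.mem_nhds hx)

/-- On `S`, the form `G` is the pullback under the local diffeomorphism `ψ` of the metric `G₀`. -/
structure IsPullback (ψ : E → E) (G₀ : E → E →L[ℝ] E →L[ℝ] ℝ) (S₀ : Set E)
    (G : E → E →L[ℝ] E →L[ℝ] ℝ) (S : Set E) : Prop where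
  metric₀ : IsMetricOn G₀ S₀
  isOpen : IsOpen S
  smooth : ∀ y ∈ S, ContDiffAt ℝ ∞ ψ y
  mapsTo : ∀ y ∈ S, ψ y ∈ S₀
  invertible : ∀ y ∈ S, (fderiv ℝ ψ y).IsInvertible
  eq : ∀ y ∈ S, ∀ u v, G y u v = G₀ (ψ y) (fderiv ℝ ψ y u) (fderiv ℝ ψ y v)

namespace IsPullback

variable {ψ : E → E} {G₀ G : E → E →L[ℝ] E →L[ℝ] ℝ} {S₀ S : Set E} {x : E}

variable [FiniteDimensional ℝ E]

theorem isMetricOn (hψ : IsPullback ψ G₀ S₀ G S) : IsMetricOn G S where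
  isOpen := hψ.isOpen
  smooth y hy := by
    refine contDiffAt_bilinear_of_apply hψ.isOpen (fun u v z hz => ContDiffAt.contDiffWithinAt ?_) hy
    have hd := (hψ.smooth z hz).fderiv_infty
    have : ContDiffAt ℝ ∞ (fun y => G₀ (ψ y) (fderiv ℝ ψ y u) (fderiv ℝ ψ y v)) z :=
      (((hψ.metric₀.smooth _ (hψ.mapsTo z hz)).comp z (hψ.smooth z hz)).clm_apply
        (hd.clm_apply contDiffAt_const)).clm_apply (hd.clm_apply contDiffAt_const)
    refine this.congr_of_eventuallyEq ?_
    filter_upwards [hψ.isOpen.mem_nhds hz] with y hy using hψ.eq y hy u v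
  symm y hy u v := by
    rw [hψ.eq y hy, hψ.eq y hy, hψ.metric₀.symm _ (hψ.mapsTo y hy)]
  invertible y hy := by
    refine isInvertible_of_nondegenerate fun u hu => (hψ.invertible y hy).injective ?_
    rw [map_zero]
    refine hψ.metric₀.eq_of_apply_eq (hψ.mapsTo y hy) fun w => ?_
    obtain ⟨v, rfl⟩ := (hψ.invertible y hy).surjective w
    rw [← hψ.eq y hy, hu]; simp

theorem fderiv_metric (hψ : IsPullback ψ G₀ S₀ G S) (hx : x ∈ S) (u v w : E) :
    fderiv ℝ G x u v w =
      fderiv ℝ G₀ (ψ x) (fderiv ℝ ψ x u) (fderiv ℝ ψ x v) (fderiv ℝ ψ x w)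
        + G₀ (ψ x) (fderiv ℝ (fderiv ℝ ψ) x u v) (fderiv ℝ ψ x w)
        + G₀ (ψ x) (fderiv ℝ ψ x v) (fderiv ℝ (fderiv ℝ ψ) x u w) := by
  have hG := hψ.isMetricOn
  have hd := (hG.smooth x hx).differentiableAt_infty
  have hs := hψ.smooth x hx
  have hd₀ := (hψ.metric₀.smooth _ (hψ.mapsTo x hx)).differentiableAt_infty
  have hψ' := hs.fderiv_infty.differentiableAt_infty
  have k : ∀ v : E, DifferentiableAt ℝ (fun _ : E => v) x := fun v => differentiableAt_const v
  have hc : DifferentiableAt ℝ (fun y => G₀ (ψ y)) x := hd₀.comp x hs.differentiableAt_infty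
  have h1 : (fun y => G y v w) =ᶠ[𝓝 x]
      fun y => G₀ (ψ y) (fderiv ℝ ψ y v) (fderiv ℝ ψ y w) := by
    filter_upwards [hψ.isOpen.mem_nhds hx] with y hy using hψ.eq y hy v w
  have h2 := congrArg (fun L : E →L[ℝ] ℝ => L u) h1.fderiv_eq
  rw [fderiv_apply_const (hd.clm_apply (k v)), fderiv_apply_const hd,
    fderiv_apply_apply (hc.clm_apply (hψ'.clm_apply (k v))) (hψ'.clm_apply (k w)),
    fderiv_apply_apply hc (hψ'.clm_apply (k v)), fderiv_apply_const hψ', fderiv_apply_const hψ',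
    fderiv_comp_apply hd₀ hs.differentiableAt_infty] at h2
  rw [h2]; simp

/-- The transformation law of the Christoffel symbols. -/
theorem christoffel (hψ : IsPullback ψ G₀ S₀ G S) (hx : x ∈ S) (u v : E) :
    fderiv ℝ ψ x (christoffel G x u v) =
      Coord.christoffel G₀ (ψ x) (fderiv ℝ ψ x u) (fderiv ℝ ψ x v)
        + fderiv ℝ (fderiv ℝ ψ) x u v := by
  have hG := hψ.isMetricOn
  have hx₀ := hψ.mapsTo x hx
  refine hψ.metric₀.eq_of_apply_eq hx₀ fun w => ?_
  obtain ⟨w, rfl⟩ := (hψ.invertible x hx).surjective w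
  rw [← hψ.eq x hx, hG.apply_christoffel hx, map_add, add_apply,
    hψ.metric₀.apply_christoffel hx₀, hψ.fderiv_metric hx, hψ.fderiv_metric hx,
    hψ.fderiv_metric hx, (hψ.smooth x hx).symm_infty v u, (hψ.smooth x hx).symm_infty w u,
    (hψ.smooth x hx).symm_infty w v, hψ.metric₀.symm _ hx₀ (fderiv ℝ ψ x u),
    hψ.metric₀.symm _ hx₀ (fderiv ℝ ψ x v)]
  ring

/-- The second derivative of ψ in the law for Γ is exactly the term produced by differentiating Dψ ·
V. -/
theorem covDeriv (hψ : IsPullback ψ G₀ S₀ G S) (hx : x ∈ S) {V V₀ : E → E}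
    (hV : DifferentiableAt ℝ V x) (hV₀ : DifferentiableAt ℝ V₀ (ψ x))
    (h : ∀ᶠ y in 𝓝 x, fderiv ℝ ψ y (V y) = V₀ (ψ y)) (u : E) :
    fderiv ℝ ψ x (covDeriv G V x u) = Coord.covDeriv G₀ V₀ (ψ x) (fderiv ℝ ψ x u) := by
  have hs := hψ.smooth x hx
  have h1 : (fun y => fderiv ℝ ψ y (V y)) =ᶠ[𝓝 x] fun y => V₀ (ψ y) := h
  have h2 := congrArg (fun L : E →L[ℝ] E => L u) h1.fderiv_eq
  rw [fderiv_apply_apply hs.fderiv_infty.differentiableAt_infty hV,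
    fderiv_comp_apply hV₀ hs.differentiableAt_infty] at h2
  rw [covDeriv_apply, covDeriv_apply, map_add, hψ.christoffel hx, ← h2, h.self_of_nhds]
  abel

/-- Obtained by differentiating the transformation law of Γ. The third derivative of ψ is symmetric
in `u` and `v`, so it drops out of the curvature. -/
theorem fderiv_christoffel (hψ : IsPullback ψ G₀ S₀ G S) (hx : x ∈ S) (u v w : E) :
    fderiv ℝ ψ x (fderiv ℝ (Coord.christoffel G) x u v w) =
      fderiv ℝ (Coord.christoffel G₀) (ψ x) (fderiv ℝ ψ x u) (fderiv ℝ ψ x v) (fderiv ℝ ψ x w)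
        + Coord.christoffel G₀ (ψ x) (fderiv ℝ (fderiv ℝ ψ) x u v) (fderiv ℝ ψ x w)
        + Coord.christoffel G₀ (ψ x) (fderiv ℝ ψ x v) (fderiv ℝ (fderiv ℝ ψ) x u w)
        + fderiv ℝ (fderiv ℝ (fderiv ℝ ψ)) x u v w
        - fderiv ℝ (fderiv ℝ ψ) x u (Coord.christoffel G x v w) := by
  have hG := hψ.isMetricOn
  have hc := (hG.contDiffAt_christoffel hx).differentiableAt_infty
  have hs := hψ.smooth x hx
  have hc₀ := (hψ.metric₀.contDiffAt_christoffel (hψ.mapsTo x hx)).differentiableAt_infty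
  have hψ' := hs.fderiv_infty.differentiableAt_infty
  have hψ'' := hs.fderiv_infty.fderiv_infty.differentiableAt_infty
  have k : ∀ v : E, DifferentiableAt ℝ (fun _ : E => v) x := fun v => differentiableAt_const v
  have hcc : DifferentiableAt ℝ (fun y => Coord.christoffel G₀ (ψ y)) x :=
    hc₀.comp x hs.differentiableAt_infty
  have h1 : (fun y => fderiv ℝ ψ y (Coord.christoffel G y v w)) =ᶠ[𝓝 x]
      fun y => Coord.christoffel G₀ (ψ y) (fderiv ℝ ψ y v) (fderiv ℝ ψ y w)
        + fderiv ℝ (fderiv ℝ ψ) y v w := by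
    filter_upwards [hψ.isOpen.mem_nhds hx] with y hy using hψ.christoffel hy v w
  have h2 := congrArg (fun L : E →L[ℝ] E => L u) h1.fderiv_eq
  rw [fderiv_fun_add ((hcc.clm_apply (hψ'.clm_apply (k v))).clm_apply (hψ'.clm_apply (k w)))
    ((hψ''.clm_apply (k v)).clm_apply (k w))] at h2
  simp only [add_apply] at h2
  rw [fderiv_apply_apply hψ' ((hc.clm_apply (k v)).clm_apply (k w)),
    fderiv_apply_const (hc.clm_apply (k v)), fderiv_apply_const hc,
    fderiv_apply_apply (hcc.clm_apply (hψ'.clm_apply (k v))) (hψ'.clm_apply (k w)),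
    fderiv_apply_apply hcc (hψ'.clm_apply (k v)), fderiv_apply_const hψ', fderiv_apply_const hψ',
    fderiv_comp_apply hc₀ hs.differentiableAt_infty, fderiv_apply_const (hψ''.clm_apply (k v)),
    fderiv_apply_const hψ''] at h2
  rw [eq_sub_iff_add_eq', h2]
  simp

/-- The naturality of the curvature tensor. -/
theorem curvature (hψ : IsPullback ψ G₀ S₀ G S) (hx : x ∈ S) (u v w : E) :
    fderiv ℝ ψ x (curvature G x v w u) =
      Coord.curvature G₀ (ψ x) (fderiv ℝ ψ x v) (fderiv ℝ ψ x w) (fderiv ℝ ψ x u) := by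
  have hs := hψ.smooth x hx
  rw [curvature_apply, curvature_apply, map_sub, map_add, map_sub, hψ.fderiv_christoffel hx,
    hψ.fderiv_christoffel hx, hψ.christoffel hx, hψ.christoffel hx, hψ.christoffel hx,
    hψ.christoffel hx, hs.symm_infty v u, hs.fderiv_infty.symm_infty v u]
  simp only [map_add]
  abel

theorem traceL_conj {e : E →L[ℝ] E} (he : e.IsInvertible) {A A₀ : E →L[ℝ] E}
    (h : ∀ u, e (A u) = A₀ (e u)) : traceL E A = traceL E A₀ := by
  obtain ⟨e, rfl⟩ := he
  rw [traceL_apply, traceL_apply, ← LinearMap.trace_conj' (A : E →ₗ[ℝ] E) e.toLinearEquiv]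
  congr 1
  ext u
  have := h (e.symm u)
  simp at this
  simpa [LinearEquiv.conj_apply] using this

theorem ricci (hψ : IsPullback ψ G₀ S₀ G S) (hx : x ∈ S) (v w : E) :
    ricci G x v w = Coord.ricci G₀ (ψ x) (fderiv ℝ ψ x v) (fderiv ℝ ψ x w) :=
  traceL_conj (hψ.invertible x hx) fun u => hψ.curvature hx u v w

theorem grad (hψ : IsPullback ψ G₀ S₀ G S) (hx : x ∈ S) {h h₀ : E → ℝ}
    (hh : ∀ᶠ y in 𝓝 x, h y = h₀ (ψ y)) (hh₀ : DifferentiableAt ℝ h₀ (ψ x)) :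
    fderiv ℝ ψ x (grad G h x) = Coord.grad G₀ h₀ (ψ x) := by
  have hx₀ := hψ.mapsTo x hx
  refine hψ.metric₀.eq_of_apply_eq hx₀ fun w => ?_
  obtain ⟨w, rfl⟩ := (hψ.invertible x hx).surjective w
  have h1 : h =ᶠ[𝓝 x] fun y => h₀ (ψ y) := hh
  rw [← hψ.eq x hx, hψ.isMetricOn.apply_grad hx, hψ.metric₀.apply_grad hx₀, h1.fderiv_eq,
    fderiv_comp_apply hh₀ (hψ.smooth x hx).differentiableAt_infty]

variable {h h₀ : E → ℝ}

theorem hessOp (hψ : IsPullback ψ G₀ S₀ G S) (hh₀ : ∀ y ∈ S₀, ContDiffAt ℝ ∞ h₀ y)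
    (hh : ∀ y ∈ S, h y = h₀ (ψ y)) (hx : x ∈ S) (u : E) :
    fderiv ℝ ψ x (hessOp G h x u) = Coord.hessOp G₀ h₀ (ψ x) (fderiv ℝ ψ x u) := by
  have hx₀ := hψ.mapsTo x hx
  have hS := hψ.isOpen.mem_nhds hx
  have h1 : h =ᶠ[𝓝 x] h₀ ∘ ψ := by filter_upwards [hS] with y hy using hh y hy
  have hsm : ContDiffAt ℝ ∞ h x :=
    ((hh₀ _ hx₀).comp x (hψ.smooth x hx)).congr_of_eventuallyEq h1
  refine hψ.covDeriv hx (hψ.isMetricOn.contDiffAt_grad hx hsm).differentiableAt_infty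
    (hψ.metric₀.contDiffAt_grad hx₀ (hh₀ _ hx₀)).differentiableAt_infty ?_ u
  filter_upwards [hS] with y hy
  refine hψ.grad hy ?_ (hh₀ _ (hψ.mapsTo y hy)).differentiableAt_infty
  filter_upwards [hψ.isOpen.mem_nhds hy] with z hz using hh z hz

/-- Every term of the equation is natural, so it can be moved to normal coordinates and between
charts. -/
theorem einsteinAt (hψ : IsPullback ψ G₀ S₀ G S) (hh₀ : ∀ y ∈ S₀, ContDiffAt ℝ ∞ h₀ y)
    (hh : ∀ y ∈ S, h y = h₀ (ψ y)) (hx : x ∈ S) {Λ : ℝ} (hE : EinsteinAt G₀ h₀ Λ (ψ x)) :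
    EinsteinAt G h Λ x := by
  have ht := traceL_conj (hψ.invertible x hx) (hψ.hessOp hh₀ hh hx)
  ext u v
  have := congrArg (fun B : E →L[ℝ] E →L[ℝ] ℝ => B (fderiv ℝ ψ x u) (fderiv ℝ ψ x v)) hE
  simp [← hψ.hessOp hh₀ hh hx, ← hψ.eq x hx, ← hψ.ricci hx, ← hh x hx, ← ht] at this
  simpa using this

end IsPullback

end Coord

/-! ### Traces, Bianchi identities and the vanishing of tr A² -/

namespace Coord

variable {E : Type*} [NormedAddCommGroup E] [NormedSpace ℝ E] [FiniteDimensional ℝ E]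

/-- The trace of an endomorphism in terms of an orthogonal basis of a nondegenerate symmetric
form. -/
theorem exists_traceL_eq_sum {B : E →L[ℝ] E →L[ℝ] ℝ} (hs : ∀ u v, B u v = B v u)
    (hB : ∀ u, (∀ v, B u v = 0) → u = 0) :
    ∃ e : Fin (Module.finrank ℝ E) → E, (∀ i, B (e i) (e i) ≠ 0) ∧
      (∀ v, (∀ i, B v (e i) = 0) → v = 0) ∧
      ∀ A : E →L[ℝ] E, traceL E A = ∑ i, (B (e i) (e i))⁻¹ * B (A (e i)) (e i) := by
  let b : LinearMap.BilinForm ℝ E :=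
    LinearMap.mk₂ ℝ (fun u v => B u v) (by simp) (by simp) (by simp) (by simp)
  have hb : LinearMap.IsSymm b := ⟨fun u v => by simpa [b] using hs u v⟩
  obtain ⟨e, he⟩ := LinearMap.BilinForm.exists_orthogonal_basis hb
  have ho : ∀ i j, i ≠ j → B (e i) (e j) = 0 := fun i j hij => by
    simpa [b, LinearMap.isOrthoᵢ_def] using he hij
  have hrepr : ∀ v i, B v (e i) = e.repr v i * B (e i) (e i) := by
    intro v i
    conv_lhs => rw [← e.sum_repr v]
    rw [map_sum, sum_apply, Finset.sum_eq_single i]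
    · simp
    · intro j _ hj; simp [ho j i hj]
    · simp
  have hne : ∀ i, B (e i) (e i) ≠ 0 := by
    intro i hi
    refine e.ne_zero i (hB _ fun v => ?_)
    rw [hs, hrepr, hi, mul_zero]
  refine ⟨e, hne, fun v hv => ?_, fun A => ?_⟩
  · refine e.repr.map_eq_zero_iff.1 (Finsupp.ext fun i => ?_)
    have := hv i
    rw [hrepr] at this
    simpa [hne i] using this
  · rw [traceL_apply, LinearMap.trace_eq_matrix_trace ℝ e, Matrix.trace]
    refine Finset.sum_congr rfl fun i _ => ?_
    rw [Matrix.diag_apply, LinearMap.toMatrix_apply, hrepr (A (e i)), mul_comm, mul_assoc,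
      mul_inv_cancel₀ (hne i), mul_one]
    rfl

theorem traceL_smulRight (l : E →L[ℝ] ℝ) (v : E) : traceL E (l.smulRight v) = l v := by
  rw [traceL_apply]
  exact LinearMap.trace_smulRight (l : E →ₗ[ℝ] ℝ) v

theorem traceL_id : traceL E (ContinuousLinearMap.id ℝ E) = Module.finrank ℝ E := by
  rw [traceL_apply]
  exact LinearMap.trace_one ℝ E

theorem fderiv_traceL {A : E → E →L[ℝ] E} {x : E} (hA : DifferentiableAt ℝ A x) (u : E) :
    fderiv ℝ (fun y => traceL E (A y)) x u = traceL E (fderiv ℝ A x u) := by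
  rw [fderiv_comp_apply (traceL E).differentiableAt hA, ContinuousLinearMap.fderiv]

/-- The Ricci operator. -/
def ricOp (G : E → E →L[ℝ] E →L[ℝ] ℝ) (x : E) : E →L[ℝ] E :=
  (G x).inverse.comp (ricci G x)

namespace IsMetricOn

variable {G : E → E →L[ℝ] E →L[ℝ] ℝ} {S : Set E} {x : E}

theorem apply_ricOp (hG : IsMetricOn G S) (hx : x ∈ S) (v w : E) :
    G x (ricOp G x v) w = ricci G x v w := by
  rw [ricOp, ContinuousLinearMap.comp_apply, hG.apply_inverse hx]

theorem contDiffAt_ricci (hG : IsMetricOn G S) (hx : x ∈ S) : ContDiffAt ℝ ∞ (ricci G) x :=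
  contDiffAt_bilinear_of_apply hG.isOpen (fun v w _ hy =>
    ((traceL E).contDiff.contDiffAt.comp _
      (hG.contDiffAt_curvature hy v w)).contDiffWithinAt) hx

theorem contDiffAt_ricOp (hG : IsMetricOn G S) (hx : x ∈ S) : ContDiffAt ℝ ∞ (ricOp G) x :=
  (hG.contDiffAt_inverse hx).clm_comp (hG.contDiffAt_ricci hx)

theorem exists_traceL_eq_sum (hG : IsMetricOn G S) (hx : x ∈ S) :
    ∃ e : Fin (Module.finrank ℝ E) → E,
      ∀ A : E →L[ℝ] E, traceL E A = ∑ i, (G x (e i) (e i))⁻¹ * G x (A (e i)) (e i) := by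
  obtain ⟨e, -, -, he⟩ := Coord.exists_traceL_eq_sum (hG.symm x hx) fun u hu =>
    hG.eq_of_apply_eq hx fun w => by simpa using hu w
  exact ⟨e, he⟩

/-- The same equation with an index raised; as an identity of endomorphisms it can be traced after
differentiation. -/
theorem einsteinAt_iff (hG : IsMetricOn G S) (hx : x ∈ S) (h : E → ℝ) (Λ : ℝ) :
    EinsteinAt G h Λ x ↔ h x • ricOp G x = hessOp G h x -
      (traceL E (hessOp G h x) + Λ) • ContinuousLinearMap.id ℝ E := by
  unfold EinsteinAt
  constructor
  · intro hE
    ext v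
    refine hG.eq_of_apply_eq hx fun w => ?_
    have := congrArg (fun B : E →L[ℝ] E →L[ℝ] ℝ => B v w) hE
    simp at this
    simp [hG.apply_ricOp hx]
    linarith
  · intro hE
    ext v w
    have := congrArg (fun A : E →L[ℝ] E => G x (A v) w) hE
    simp [hG.apply_ricOp hx] at this
    simp
    linarith

section Normal

/-- The terms quadratic in Γ have zero derivative where Γ = 0, and there the ordinary derivative of
the curvature is its covariant derivative. -/
theorem fderiv_curvature (hG : IsMetricOn G S) (hx : x ∈ S) (hΓ : christoffel G x = 0)
    (a u v w : E) :
    fderiv ℝ (fun y => curvature G y v w) x a u =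
      fderiv ℝ (fderiv ℝ (christoffel G)) x a u v w
        - fderiv ℝ (fderiv ℝ (christoffel G)) x a v u w := by
  have hR := (hG.contDiffAt_curvature hx v w).differentiableAt_infty
  have hc := (hG.contDiffAt_christoffel hx).differentiableAt_infty
  have hc' := (hG.contDiffAt_christoffel hx).fderiv_infty.differentiableAt_infty
  have k : ∀ v : E, DifferentiableAt ℝ (fun _ : E => v) x := fun v => differentiableAt_const v
  have hcc : ∀ u v : E, DifferentiableAt ℝ (fun y => christoffel G y u v) x := fun u v =>
    (hc.clm_apply (k u)).clm_apply (k v)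
  have hd : ∀ u v w : E, DifferentiableAt ℝ (fun y => fderiv ℝ (christoffel G) y u v w) x :=
    fun u v w => ((hc'.clm_apply (k u)).clm_apply (k v)).clm_apply (k w)
  have hd' : ∀ u v w : E, fderiv ℝ (fun y => fderiv ℝ (christoffel G) y u v w) x a =
      fderiv ℝ (fderiv ℝ (christoffel G)) x a u v w := fun u v w => by
    rw [fderiv_apply_const ((hc'.clm_apply (k u)).clm_apply (k v)),
      fderiv_apply_const (hc'.clm_apply (k u)), fderiv_apply_const hc']
  have hq : ∀ u v w : E, DifferentiableAt ℝ
      (fun y => christoffel G y u (christoffel G y v w)) x :=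
    fun u v w => (hc.clm_apply (k u)).clm_apply (hcc v w)
  have hq' : ∀ u v w : E,
      fderiv ℝ (fun y => christoffel G y u (christoffel G y v w)) x a = 0 := fun u v w => by
    rw [fderiv_apply_apply (hc.clm_apply (k u)) (hcc v w), hΓ]
    simp
  rw [← fderiv_apply_const hR]
  simp only [curvature_apply]
  rw [fderiv_fun_sub (((hd u v w).fun_sub (hd v u w)).fun_add (hq u v w)) (hq v u w),
    fderiv_fun_add ((hd u v w).fun_sub (hd v u w)) (hq u v w),
    fderiv_fun_sub (hd u v w) (hd v u w)]
  simp only [add_apply, sub_apply, hq', hd']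
  simp

/-- The differential Bianchi identity. -/
theorem bianchi (hG : IsMetricOn G S) (hx : x ∈ S) (hΓ : christoffel G x = 0) (a u v w : E) :
    fderiv ℝ (fun y => curvature G y v w) x a u + fderiv ℝ (fun y => curvature G y a w) x u v
      + fderiv ℝ (fun y => curvature G y u w) x v a = 0 := by
  have hs := (hG.contDiffAt_christoffel hx).symm_infty
  rw [hG.fderiv_curvature hx hΓ, hG.fderiv_curvature hx hΓ, hG.fderiv_curvature hx hΓ,
    hs u a, hs v a, hs u v]
  abel

omit [FiniteDimensional ℝ E] in
theorem fderiv_inner_of_normal (hG : IsMetricOn G S) (hx : x ∈ S) (hΓ : christoffel G x = 0)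
    {V : E → E} (hV : DifferentiableAt ℝ V x) (a w : E) :
    fderiv ℝ (fun y => G y (V y) w) x a = G x (fderiv ℝ V x a) w := by
  rw [hG.fderiv_inner hx hV (differentiableAt_const w), covDeriv_apply, covDeriv_apply, hΓ]
  simp

theorem fderiv_curvature_skew (hG : IsMetricOn G S) (hx : x ∈ S) (hΓ : christoffel G x = 0)
    (a u v w z : E) :
    G x (fderiv ℝ (fun y => curvature G y v w) x a u) z =
      - G x (fderiv ℝ (fun y => curvature G y v z) x a u) w := by
  have hR : ∀ w, DifferentiableAt ℝ (fun y => curvature G y v w) x := fun w =>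
    (hG.contDiffAt_curvature hx v w).differentiableAt_infty
  rw [← fderiv_apply_const (hR w), ← fderiv_apply_const (hR z),
    ← hG.fderiv_inner_of_normal hx hΓ ((hR w).clm_apply (differentiableAt_const u)),
    ← hG.fderiv_inner_of_normal hx hΓ ((hR z).clm_apply (differentiableAt_const u)),
    ← neg_apply, ← fderiv_fun_neg]
  have : (fun y => G y (curvature G y v w u) z) =ᶠ[𝓝 x]
      fun y => -G y (curvature G y v z u) w := by
    filter_upwards [hG.eventually hx] with y hy using hG.curvature_skew hy u v w z
  rw [this.fderiv_eq]

/-- Where Γ = 0 the metric has zero derivative, so raising an index commutes with differentiation.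
-/
theorem apply_fderiv_ricOp (hG : IsMetricOn G S) (hx : x ∈ S) (hΓ : christoffel G x = 0)
    (a v w : E) :
    G x (fderiv ℝ (ricOp G) x a v) w =
      traceL E (fderiv ℝ (fun y => curvature G y v w) x a) := by
  have hR := (hG.contDiffAt_ricOp hx).differentiableAt_infty
  rw [← fderiv_apply_const hR, ← hG.fderiv_inner_of_normal hx hΓ
    (hR.clm_apply (differentiableAt_const v)),
    ← fderiv_traceL (hG.contDiffAt_curvature hx v w).differentiableAt_infty]
  have : (fun y => G y (ricOp G y v) w) =ᶠ[𝓝 x] fun y => traceL E (curvature G y v w) := by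
    filter_upwards [hG.eventually hx] with y hy
    rw [hG.apply_ricOp hy, ricci_eq_traceL]
  rw [this.fderiv_eq]

/-- The contracted Bianchi identity `dτ = 2 div ρ`. -/
theorem traceL_fderiv_ricOp (hG : IsMetricOn G S) (hx : x ∈ S) (hΓ : christoffel G x = 0) (v : E) :
    traceL E (fderiv ℝ (ricOp G) x v) = 2 * traceL E ((fderiv ℝ (ricOp G) x).flip v) := by
  obtain ⟨e, he⟩ := hG.exists_traceL_eq_sum hx
  set D : E → E → E → E → E := fun a u v w => fderiv ℝ (fun y => curvature G y v w) x a u with hD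
  set ε : Fin (Module.finrank ℝ E) → ℝ := fun i => (G x (e i) (e i))⁻¹ with hε
  have h1 : traceL E (fderiv ℝ (ricOp G) x v) =
      ∑ i, ∑ j, ε i * (ε j * G x (D v (e j) (e i) (e i)) (e j)) := by
    rw [he]
    refine Finset.sum_congr rfl fun i _ => ?_
    rw [hG.apply_fderiv_ricOp hx hΓ, he, Finset.mul_sum]
  have h2 : traceL E ((fderiv ℝ (ricOp G) x).flip v) =
      ∑ i, ∑ j, ε i * (ε j * G x (D (e i) (e j) v (e i)) (e j)) := by
    rw [he]
    refine Finset.sum_congr rfl fun i _ => ?_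
    rw [ContinuousLinearMap.flip_apply, hG.apply_fderiv_ricOp hx hΓ, he, Finset.mul_sum]
  have hanti : ∀ a u v w, D a u v w = - D a v u w := by
    intro a u v w
    rw [hD]; simp only
    rw [hG.fderiv_curvature hx hΓ, hG.fderiv_curvature hx hΓ]
    abel
  -- The differential Bianchi identity in the directions v, e_j, e_i, with skewness used to bring
  -- both remaining terms to the form of a divergence.
  have hb : ∀ i j, G x (D v (e j) (e i) (e i)) (e j) =
      G x (D (e j) (e i) v (e j)) (e i) + G x (D (e i) (e j) v (e i)) (e j) := by
    intro i j
    have hbi : D v (e j) (e i) (e i) + D (e j) (e i) v (e i) + D (e i) v (e j) (e i) = 0 :=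
      hG.bianchi hx hΓ v (e j) (e i) (e i)
    rw [hanti (e i) v] at hbi
    have h4 : G x (D (e j) (e i) v (e i)) (e j) = - G x (D (e j) (e i) v (e j)) (e i) :=
      hG.fderiv_curvature_skew hx hΓ _ _ _ _ _
    have h5 := congrArg (fun z => G x z (e j)) hbi
    simp only [map_add, map_neg, add_apply, neg_apply, map_zero, zero_apply] at h5
    linarith
  -- The two divergence terms differ by exchanging i and j, hence the factor 2.
  have h3 : ∑ i, ∑ j, ε i * (ε j * G x (D (e j) (e i) v (e j)) (e i)) =
      ∑ i, ∑ j, ε i * (ε j * G x (D (e i) (e j) v (e i)) (e j)) := by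
    rw [Finset.sum_comm]
    refine Finset.sum_congr rfl fun i _ => Finset.sum_congr rfl fun j _ => ?_
    ring
  rw [h1, h2, two_mul]
  conv_rhs => enter [1]; rw [← h3]
  rw [← Finset.sum_add_distrib]
  refine Finset.sum_congr rfl fun i _ => ?_
  rw [← Finset.sum_add_distrib]
  refine Finset.sum_congr rfl fun j _ => ?_
  rw [hb]; ring

variable {h : E → ℝ}

/-- The Ricci identity for the gradient of a function. -/
theorem fderiv_hessOp_flip (hG : IsMetricOn G S) (hx : x ∈ S) (hΓ : christoffel G x = 0)
    (hh : ContDiffAt ℝ ∞ h x) (v : E) :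
    (fderiv ℝ (hessOp G h) x).flip v = fderiv ℝ (hessOp G h) x v + curvature G x v (grad G h x) := by
  have hA := (hG.contDiffAt_hessOp hx hh).differentiableAt_infty
  have hU := hG.contDiffAt_grad hx hh
  have hc := (hG.contDiffAt_christoffel hx).differentiableAt_infty
  have k : ∀ v : E, DifferentiableAt ℝ (fun _ : E => v) x := fun v => differentiableAt_const v
  have key : ∀ a v, fderiv ℝ (hessOp G h) x a v =
      fderiv ℝ (fderiv ℝ (grad G h)) x a v + fderiv ℝ (christoffel G) x a v (grad G h x) := by
    intro a v
    rw [← fderiv_apply_const hA]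
    simp only [hessOp, covDeriv_apply]
    rw [fderiv_fun_add (hU.fderiv_infty.differentiableAt_infty.clm_apply (k v))
      ((hc.clm_apply (k v)).clm_apply hU.differentiableAt_infty), add_apply,
      fderiv_apply_const hU.fderiv_infty.differentiableAt_infty,
      fderiv_apply_apply (hc.clm_apply (k v)) hU.differentiableAt_infty, fderiv_apply_const hc, hΓ]
    simp
  ext u
  rw [ContinuousLinearMap.flip_apply, add_apply, key, key, curvature_apply, hU.symm_infty u v, hΓ]
  simp

variable {Λ : ℝ}

/-- The second conclusion is τ dh = (1 - n) d(tr A) multiplied by `h`, with hτ eliminated by the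
traced equation; it later yields Λ = 0. -/
theorem traceL_hessOp_sq_of_normal (hG : IsMetricOn G S) (hx : x ∈ S) (hΓ : christoffel G x = 0)
    (hE : 2 ≤ Module.finrank ℝ E) (hh : ∀ y ∈ S, ContDiffAt ℝ ∞ h y) (hpos : h x ≠ 0)
    (hnull : ∀ y ∈ S, G y (grad G h y) (grad G h y) = 0)
    (heq : ∀ y ∈ S, EinsteinAt G h Λ y) :
    traceL E ((hessOp G h x).comp (hessOp G h x)) = 0 ∧
      ∀ v, fderiv ℝ h x v * (traceL E (hessOp G h x)
        - Module.finrank ℝ E * (traceL E (hessOp G h x) + Λ)) =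
        h x * ((1 - Module.finrank ℝ E) * traceL E (fderiv ℝ (hessOp G h) x v)) := by
  set U := grad G h with hU
  set A := hessOp G h with hA
  have hUs : DifferentiableAt ℝ U x := (hG.contDiffAt_grad hx (hh x hx)).differentiableAt_infty
  have hAs : DifferentiableAt ℝ A x := (hG.contDiffAt_hessOp hx (hh x hx)).differentiableAt_infty
  have hRs := (hG.contDiffAt_ricOp hx).differentiableAt_infty
  have hhs := (hh x hx).differentiableAt_infty
  have hS := hG.eventually hx
  have hAU : ∀ y ∈ S, A y (U y) = 0 := fun y hy => hG.hessOp_grad hy (hh y hy) (by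
    filter_upwards [hG.eventually hy] with z hz using hnull z hz)
  have hop : ∀ y ∈ S, h y • ricOp G y = A y - (traceL E (A y) + Λ) • ContinuousLinearMap.id ℝ E :=
    fun y hy => (hG.einsteinAt_iff hy h Λ).1 (heq y hy)
  have hdf : ∀ v, fderiv ℝ h x v = G x (U x) v := fun v => (hG.apply_grad hx h v).symm
  -- ρ(U, U) = 0: pair the equation with U twice and use AU = 0 and g(U, U) = 0.
  have hRUU : traceL E (curvature G x (U x) (U x)) = 0 := by
    have h1 := congrArg (fun L : E →L[ℝ] E => G x (L (U x)) (U x)) (hop x hx)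
    simp only [smul_apply, sub_apply, map_smul, map_sub, ContinuousLinearMap.id_apply,
      smul_eq_mul, hAU x hx, hnull x hx, hG.apply_ricOp hx, ricci_eq_traceL, map_zero,
      zero_apply, mul_zero, sub_zero, mul_eq_zero] at h1
    exact h1.resolve_left hpos
  set c : E → ℝ := fun y => traceL E (A y) + Λ with hc
  have hcs : DifferentiableAt ℝ c x := ((traceL E).differentiableAt.comp x hAs).add_const _
  have hdc : ∀ v, fderiv ℝ c x v = traceL E (fderiv ℝ A x v) := fun v => by
    rw [hc, fderiv_add_const, fderiv_traceL hAs]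
  have hdiff : ∀ a, fderiv ℝ h x a • ricOp G x + h x • fderiv ℝ (ricOp G) x a =
      fderiv ℝ A x a - fderiv ℝ c x a • ContinuousLinearMap.id ℝ E := by
    intro a
    have h1 : (fun y => h y • ricOp G y) =ᶠ[𝓝 x]
        fun y => A y - c y • ContinuousLinearMap.id ℝ E := by
      filter_upwards [hS] with y hy using hop y hy
    have h2 := congrArg (fun L : E →L[ℝ] (E →L[ℝ] E) => L a) h1.fderiv_eq
    rw [fderiv_fun_smul hhs hRs, fderiv_fun_sub hAs (hcs.smul_const _),
      fderiv_smul_const hcs] at h2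
    simp only [add_apply, sub_apply, smul_apply, ContinuousLinearMap.smulRight_apply] at h2
    rw [← h2, add_comm]
  have hflip : ∀ v, (fderiv ℝ A x).flip v = fderiv ℝ A x v + curvature G x v (U x) :=
    hG.fderiv_hessOp_flip hx hΓ (hh x hx)
  have hdiv : ∀ v, traceL E ((fderiv ℝ (ricOp G) x).flip v) = 0 := by
    intro v
    -- The differentiated equation, evaluated on `v` and read as an endomorphism in the direction of
    -- differentiation; its trace is a divergence. There ρ(v, U) and d(tr A)(v) cancel.
    have h1 : (fderiv ℝ h x).smulRight (ricOp G x v) + h x • (fderiv ℝ (ricOp G) x).flip v =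
        (fderiv ℝ A x).flip v - (fderiv ℝ c x).smulRight v := by
      ext a
      have := congrArg (fun L : E →L[ℝ] E => L v) (hdiff a)
      simpa using this
    have h2 := congrArg (traceL E) h1
    rw [hflip, map_add, map_sub, map_smul, traceL_smulRight, traceL_smulRight, map_add, hdc, hdf,
      hG.symm x hx, hG.apply_ricOp hx, ricci_eq_traceL, smul_eq_mul] at h2
    have h3 : h x * traceL E ((fderiv ℝ (ricOp G) x).flip v) = 0 := by linarith
    exact (mul_eq_zero.1 h3).resolve_left hpos
  -- Tracing instead the endomorphism itself gives dτ, which vanishes by the contracted Bianchi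
  -- identity.
  have htr : ∀ v, fderiv ℝ h x v * traceL E (ricOp G x) =
      (1 - Module.finrank ℝ E) * traceL E (fderiv ℝ A x v) := by
    intro v
    have h1 := congrArg (traceL E) (hdiff v)
    rw [map_add, map_sub, map_smul, map_smul, map_smul, hG.traceL_fderiv_ricOp hx hΓ, hdiv, hdc,
      traceL_id] at h1
    simp only [smul_eq_mul, mul_zero, add_zero] at h1
    rw [h1]; ring
  -- Here dh(U) = g(U, U) = 0, and 1 - n ≠ 0.
  have hdU : traceL E (fderiv ℝ A x (U x)) = 0 := by
    have h1 := htr (U x)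
    rw [hdf, hnull x hx, zero_mul] at h1
    refine (mul_eq_zero.1 h1.symm).resolve_left ?_
    have : (2 : ℝ) ≤ Module.finrank ℝ E := by exact_mod_cast hE
    linarith
  refine ⟨?_, fun v => ?_⟩
  -- Differentiating AU = 0 gives (∇_a A)U = -A(∇_a U) = -A²a.
  · have h1 : (fderiv ℝ A x).flip (U x) = -((A x).comp (A x)) := by
      ext a
      have h2 : (fun y => A y (U y)) =ᶠ[𝓝 x] fun _ => 0 := by
        filter_upwards [hS] with y hy using hAU y hy
      have h3 := congrArg (fun L : E →L[ℝ] E => L a) h2.fderiv_eq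
      rw [fderiv_apply_apply hAs hUs] at h3
      have h4 : A x a = fderiv ℝ U x a := by
        rw [hA, hessOp, covDeriv_apply, hΓ]; simp [hU]
      simp only [fderiv_const_apply, zero_apply, ← h4] at h3
      simpa using eq_neg_of_add_eq_zero_left h3
    have h2 := congrArg (traceL E) (hflip (U x))
    rw [h1, map_neg, map_add, hdU, hRUU] at h2
    linarith
  · have h1 := congrArg (traceL E) (hop x hx)
    rw [map_smul, map_sub, map_smul, traceL_id] at h1
    rw [← htr v]
    simp only [smul_eq_mul] at h1
    linear_combination (-fderiv ℝ h x v) * h1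

end Normal

end IsMetricOn

/-! ### Coordinates with vanishing Christoffel symbols at a point -/

/-- Coordinates in which the Christoffel symbols vanish at the origin, after a translation by `x`. -/
def quadraticMap (G : E → E →L[ℝ] E →L[ℝ] ℝ) (x y : E) : E :=
  x + y - (1 / 2 : ℝ) • christoffel G x y y

omit [FiniteDimensional ℝ E] in
theorem contDiff_quadraticMap (G : E → E →L[ℝ] E →L[ℝ] ℝ) (x : E) :
    ContDiff ℝ ∞ (quadraticMap G x) := by
  have : ContDiff ℝ ∞ fun y => christoffel G x y y :=
    ((christoffel G x).contDiff).clm_apply contDiff_id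
  exact (contDiff_const.add contDiff_id).sub (contDiff_const.smul this)

omit [FiniteDimensional ℝ E] in
theorem fderiv_quadraticMap (G : E → E →L[ℝ] E →L[ℝ] ℝ) (x y : E) :
    fderiv ℝ (quadraticMap G x) y = ContinuousLinearMap.id ℝ E
      - (1 / 2 : ℝ) • (christoffel G x + (christoffel G x).flip) y := by
  have hc := (christoffel G x).differentiableAt (x := y)
  have hd : DifferentiableAt ℝ (fun y => christoffel G x y y) y :=
    hc.clm_apply differentiableAt_id
  ext u
  have h1 : fderiv ℝ (fun y => christoffel G x y y) y u =
      christoffel G x u y + christoffel G x y u := by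
    rw [fderiv_apply_apply (V := fun y => y) hc differentiableAt_id]
    simp
  unfold quadraticMap
  rw [fderiv_fun_sub (f := fun y => x + y) (g := fun y => (1 / 2 : ℝ) • christoffel G x y y)
    (by fun_prop) (hd.const_smul (1 / 2 : ℝ)),
    fderiv_const_add, fderiv_fun_const_smul hd]
  simp [h1, add_comm]

theorem isInvertible_nhds :
    ∀ᶠ A in 𝓝 (ContinuousLinearMap.id ℝ E), A.IsInvertible := by
  have := FiniteDimensional.complete ℝ E
  exact ContinuousLinearEquiv.nhds (ContinuousLinearEquiv.refl ℝ E)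

namespace IsMetricOn

variable {G : E → E →L[ℝ] E →L[ℝ] ℝ} {S : Set E} {x : E}

theorem exists_isPullback_normal (hG : IsMetricOn G S) (hx : x ∈ S) :
    ∃ (ψ : E → E) (G' : E → E →L[ℝ] E →L[ℝ] ℝ) (S' : Set E), IsPullback ψ G S G' S' ∧
      (0 : E) ∈ S' ∧ ψ 0 = x ∧ fderiv ℝ ψ 0 = ContinuousLinearMap.id ℝ E ∧
      christoffel G' 0 = 0 := by
  set ψ := quadraticMap G x with hψ
  have hs := contDiff_quadraticMap G x
  have h0 : ψ 0 = x := by simp [hψ, quadraticMap]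
  have hd0 : fderiv ℝ ψ 0 = ContinuousLinearMap.id ℝ E := by
    rw [hψ, fderiv_quadraticMap]; simp
  -- The factor 1/2 in ψ makes its second derivative equal to -Γ, which cancels Γ in the
  -- transformation law.
  have hdd : ∀ u v, fderiv ℝ (fderiv ℝ ψ) 0 u v = - christoffel G x u v := by
    intro u v
    have h1 : fderiv ℝ ψ = fun y => ContinuousLinearMap.id ℝ E
      - (1 / 2 : ℝ) • (christoffel G x + (christoffel G x).flip) y :=
      funext (fderiv_quadraticMap G x)
    have hd := (christoffel G x + (christoffel G x).flip).differentiableAt (x := (0 : E))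
    rw [h1, fderiv_const_sub, fderiv_fun_const_smul hd, ContinuousLinearMap.fderiv]
    simp only [neg_apply, smul_apply, add_apply, ContinuousLinearMap.flip_apply]
    rw [hG.christoffel_symm hx v u, ← two_smul ℝ, smul_smul]
    norm_num
  have hcont : Continuous (fderiv ℝ ψ) := hs.continuous_fderiv (by simp)
  have hev : ∀ᶠ y in 𝓝 (0 : E), ψ y ∈ S ∧ (fderiv ℝ ψ y).IsInvertible := by
    refine Filter.Eventually.and ?_ ?_
    · exact hs.continuous.continuousAt.eventually_mem (by rw [← hψ, h0]; exact hG.isOpen.mem_nhds hx)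
    · exact hcont.continuousAt.eventually (by rw [hd0]; exact isInvertible_nhds)
  obtain ⟨S', hS', ho, hm⟩ := eventually_nhds_iff.1 hev
  have hp : IsPullback ψ G S (fun y => (G (ψ y)).bilinearComp (fderiv ℝ ψ y) (fderiv ℝ ψ y)) S' :=
    { metric₀ := hG
      isOpen := ho
      smooth := fun y _ => hs.contDiffAt
      mapsTo := fun y hy => (hS' y hy).1
      invertible := fun y hy => (hS' y hy).2
      eq := fun y _ u v => rfl }
  refine ⟨ψ, _, S', hp, hm, h0, hd0, ?_⟩
  ext u v
  have := hp.christoffel hm u v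
  rw [hd0, h0, hdd] at this
  simpa using this

variable {h : E → ℝ} {Λ : ℝ}

/-- Isotropic solutions have a Hessian operator of zero square trace, and the cosmological constant
vanishes when the Laplacian does. -/
theorem traceL_hessOp_sq (hG : IsMetricOn G S) (hx : x ∈ S)
    (hE : 2 ≤ Module.finrank ℝ E) (hh : ∀ y ∈ S, ContDiffAt ℝ ∞ h y) (hpos : h x ≠ 0)
    (hnull : ∀ y ∈ S, G y (grad G h y) (grad G h y) = 0)
    (heq : ∀ y ∈ S, EinsteinAt G h Λ y) (hdh : fderiv ℝ h x ≠ 0) :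
    traceL E ((hessOp G h x).comp (hessOp G h x)) = 0 ∧
      ((∀ y ∈ S, traceL E (hessOp G h y) = 0) → Λ = 0) := by
  obtain ⟨ψ, G', S', hp, hm, h0, hd0, hΓ⟩ := hG.exists_isPullback_normal hx
  have hG' := hp.isMetricOn
  have hh' : ∀ y ∈ S', ContDiffAt ℝ ∞ (fun y => h (ψ y)) y := fun y hy =>
    (hh _ (hp.mapsTo y hy)).comp y (hp.smooth y hy)
  have hgrad : ∀ y ∈ S', fderiv ℝ ψ y (grad G' (fun y => h (ψ y)) y) = grad G h (ψ y) :=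
    fun y hy => hp.grad hy (.of_forall fun _ => rfl) (hh _ (hp.mapsTo y hy)).differentiableAt_infty
  have hhess : ∀ y ∈ S', ∀ u, fderiv ℝ ψ y (hessOp G' (fun y => h (ψ y)) y u) =
      hessOp G h (ψ y) (fderiv ℝ ψ y u) := fun y hy =>
    hp.hessOp hh (fun _ _ => rfl) hy
  have htr : ∀ y ∈ S', traceL E (hessOp G' (fun y => h (ψ y)) y) = traceL E (hessOp G h (ψ y)) :=
    fun y hy => IsPullback.traceL_conj (hp.invertible y hy) (hhess y hy)
  obtain ⟨h1, h2⟩ := hG'.traceL_hessOp_sq_of_normal (h := fun y => h (ψ y)) (Λ := Λ) hm hΓ hE hh'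
    (by rwa [h0]) (fun y hy => by rw [hp.eq y hy, hgrad y hy, hnull _ (hp.mapsTo y hy)])
    (fun y hy => hp.einsteinAt hh (fun _ _ => rfl) hy (heq _ (hp.mapsTo y hy)))
  have hcoe : hessOp G' (fun y => h (ψ y)) 0 = hessOp G h x := by
    ext u
    have := hhess 0 hm u
    rwa [hd0, h0] at this
  rw [hcoe] at h1
  refine ⟨h1, fun ht => ?_⟩
  have hz : (fun y => traceL E (hessOp G' (fun y => h (ψ y)) y)) =ᶠ[𝓝 0] fun _ => 0 := by
    filter_upwards [hG'.eventually hm] with y hy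
    rw [htr y hy, ht _ (hp.mapsTo y hy)]
  have hdz : ∀ v, traceL E (fderiv ℝ (hessOp G' (fun y => h (ψ y))) 0 v) = 0 := fun v => by
    rw [← fderiv_traceL (hG'.contDiffAt_hessOp hm (hh' 0 hm)).differentiableAt_infty, hz.fderiv_eq]
    simp
  obtain ⟨v, hv⟩ : ∃ v, fderiv ℝ h x v ≠ 0 := by
    by_contra! hcon
    exact hdh (by ext v; simpa using hcon v)
  -- When tr A vanishes on `S`, this identity reduces to -nΛ dh(v) = 0.
  have h3 := h2 v
  have hx' : DifferentiableAt ℝ h (ψ 0) := by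
    rw [h0]; exact (hh x hx).differentiableAt_infty
  rw [hcoe, hdz, ht x hx, fderiv_comp_apply hx' (hp.smooth 0 hm).differentiableAt_infty, hd0, h0]
    at h3
  simp [hv] at h3
  exact h3.resolve_left (by omega)

end IsMetricOn

end Coord

/-! ### Self-adjoint endomorphisms of Euclidean and Lorentzian spaces -/

namespace Coord

variable {E : Type*} [NormedAddCommGroup E] [NormedSpace ℝ E] [FiniteDimensional ℝ E]

theorem traceL_comp_comm (A B : E →L[ℝ] E) : traceL E (A.comp B) = traceL E (B.comp A) := by
  rw [traceL_apply, traceL_apply]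
  exact LinearMap.trace_mul_comm ℝ (A : E →ₗ[ℝ] E) (B : E →ₗ[ℝ] E)

/-- A self-adjoint endomorphism of a Euclidean space whose square is traceless vanishes. -/
theorem eq_zero_of_traceL_sq {Q : E →L[ℝ] E →L[ℝ] ℝ} (hs : ∀ u v, Q u v = Q v u)
    (hpos : ∀ u, u ≠ 0 → 0 < Q u u) {C : E →L[ℝ] E} (hC : ∀ u v, Q (C u) v = Q u (C v))
    (ht : traceL E (C.comp C) = 0) : C = 0 := by
  obtain ⟨e, he, hz, hsum⟩ := exists_traceL_eq_sum hs fun u hu => by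
    by_contra hne
    exact (hpos u hne).ne' (hu u)
  have hnn : ∀ u, 0 ≤ Q u u := fun u => by
    rcases eq_or_ne u 0 with rfl | hu
    · simp
    · exact (hpos u hu).le
  rw [hsum] at ht
  -- The trace becomes a sum of terms Q(C e_i, C e_i) / Q(e_i, e_i), all nonnegative.
  simp only [ContinuousLinearMap.comp_apply, hC] at ht
  rw [Finset.sum_eq_zero_iff_of_nonneg fun i _ => mul_nonneg (inv_nonneg.2 (hnn _)) ?_] at ht
  · have hCe : ∀ i, C (e i) = 0 := by
      intro i
      have h1 := ht i (Finset.mem_univ i)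
      rw [← hC] at h1
      by_contra hne
      rw [hC, ← hC, hC] at h1
      have h2 := hpos _ hne
      rw [hC] at h2
      exact (mul_pos (inv_pos.2 ((hnn _).lt_of_ne' (he i))) h2).ne' h1
    ext v
    refine hz _ fun i => ?_
    rw [hC, hCe, map_zero]
  · rw [← hC]; exact hnn _

/-- Self-adjoint endomorphisms of a Lorentzian space that annihilate a lightlike vector `U` and have
a traceless square. -/
theorem lorentz_selfAdjoint {B : E →L[ℝ] E →L[ℝ] ℝ} (hs : ∀ u v, B u v = B v u) {t : E}
    (ht : B t t < 0) (hpos : ∀ v, B t v = 0 → v ≠ 0 → 0 < B v v) {U : E} (hU : U ≠ 0)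
    (hUU : B U U = 0) {A : E →L[ℝ] E} (hA : ∀ u v, B (A u) v = B u (A v)) (hAU : A U = 0)
    (htr : traceL E (A.comp A) = 0) :
    traceL E A = 0 ∧ (∀ w, B w U = 0 → ∃ c : ℝ, A w = c • U) ∧
      ((∀ v, A (A v) = 0) → ∀ v, ∃ c : ℝ, A v = c • U) := by
  -- A nonzero vector orthogonal to the timelike `t` has positive square, so it cannot be lightlike.
  have hb : B U t ≠ 0 := by
    intro h
    exact (hpos U (by rw [hs, h]) hU).ne' hUU
  set b := B U t with hbdef
  -- The splitting v = Pv + α(v)U + β(v)t, with `P` the orthogonal projection onto {U, t}^⊥. This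
  -- complement is a model of U^⊥/ℝU.
  set β : E →L[ℝ] ℝ := b⁻¹ • B U with hβ
  set α : E →L[ℝ] ℝ := b⁻¹ • (B t - B t t • β) with hα
  set P : E →L[ℝ] E := ContinuousLinearMap.id ℝ E - α.smulRight U - β.smulRight t with hP
  have hβv : ∀ v, β v = b⁻¹ * B U v := fun v => rfl
  have hαv : ∀ v, α v = b⁻¹ * (B t v - B t t * β v) := fun v => rfl
  have hPv : ∀ v, P v = v - α v • U - β v • t := fun v => rfl
  have hdec : ∀ v, v = P v + α v • U + β v • t := fun v => by rw [hPv]; abel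
  have hPU' : ∀ v, B U (P v) = 0 := by
    intro v
    rw [hPv, map_sub, map_sub, map_smul, map_smul, hUU, ← hbdef, hβv]
    simp only [smul_eq_mul]
    field_simp
    ring
  have hPt' : ∀ v, B t (P v) = 0 := by
    intro v
    rw [hPv, map_sub, map_sub, map_smul, map_smul, hs t U, ← hbdef, hαv]
    simp only [smul_eq_mul]
    field_simp
    ring
  have hβU : β U = 0 := by rw [hβv, hUU, mul_zero]
  have hαU : α U = 1 := by
    rw [hαv, hβU, hs t U, mul_zero, sub_zero, inv_mul_cancel₀ hb]
  have hPU : P U = 0 := by rw [hPv, hβU, hαU]; simp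
  have hPP' : ∀ u v, B (P u) (P v) = B (P u) v := by
    intro u v
    conv_rhs => rw [hdec v]
    rw [map_add, map_add, map_smul, map_smul, hs (P u) U, hs (P u) t, hPU', hPt']
    simp
  have hPsa : ∀ u v, B (P u) v = B u (P v) := by
    intro u v
    rw [← hPP', hs, hPP', hs]
  have hPP : ∀ v, P (P v) = P v := by
    intro v
    have h1 : α (P v) = 0 := by rw [hαv, hβv, hPU', hPt']; simp
    have h2 : β (P v) = 0 := by rw [hβv, hPU']; simp
    rw [hPv (P v), h1, h2]; simp
  have hAUv : ∀ v, B U (A v) = 0 := fun v => by rw [← hA, hAU]; simp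
  have hβA : ∀ v, β (A v) = 0 := fun v => by rw [hβv, hAUv, mul_zero]
  have hAdec : ∀ v, A v = P (A v) + α (A v) • U := fun v => by
    conv_lhs => rw [hdec (A v), hβA, zero_smul, add_zero]
  have hAAP : ∀ v, A (A v) = A (P (A v)) := fun v => by
    conv_lhs => rw [hAdec v, map_add, map_smul, hAU, smul_zero, add_zero]
  have hAP : ∀ v, A v = A (P v) + β v • A t := fun v => by
    conv_lhs => rw [hdec v, map_add, map_add, map_smul, map_smul, hAU, smul_zero, add_zero]
  -- The compression PAP represents the endomorphism that A induces on U^⊥/ℝU.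
  have hC : P.comp (A.comp P) = 0 := by
    set C := P.comp (A.comp P) with hCdef
    have hCv : ∀ v, C v = P (A (P v)) := fun v => rfl
    -- Reversing the sign of `B` along `t` makes it positive definite without changing it on t^⊥,
    -- where `C` takes its values.
    let Q : E →L[ℝ] E →L[ℝ] ℝ := B - (2 / B t t) • (B t).smulRight (B t)
    have hQ : ∀ u v, Q u v = B u v - 2 / B t t * (B t u * B t v) := fun u v => by
      simp [Q]
    have hCsa : ∀ u v, B (C u) v = B u (C v) := fun u v => by
      rw [hCv, hCv, hPsa, hA, hPsa]
    refine eq_zero_of_traceL_sq (Q := Q) (fun u v => by rw [hQ, hQ, hs]; ring) ?_ ?_ ?_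
    · intro u hu
      set s := B t u / B t t with hsd
      have hw : B t (u - s • t) = 0 := by
        rw [map_sub, map_smul, hsd, smul_eq_mul, div_mul_cancel₀ _ ht.ne, sub_self]
      have hbu : B t u = s * B t t := by rw [hsd, div_mul_cancel₀ _ ht.ne]
      have huu : B u u = B (u - s • t) (u - s • t) + s ^ 2 * B t t := by
        simp only [map_sub, map_smul, sub_apply, smul_apply, smul_eq_mul]
        rw [hs u t, hbu]; ring
      have hQu : Q u u = B (u - s • t) (u - s • t) - s ^ 2 * B t t := by
        rw [hQ, huu, hbu]
        field_simp [ht.ne]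
        ring
      rw [hQu]
      rcases eq_or_ne (u - s • t) 0 with h0 | h0
      · have hs0 : s ≠ 0 := by
          rintro h
          rw [h, zero_smul, sub_zero] at h0
          exact hu h0
        rw [h0, map_zero]
        have := mul_neg_of_pos_of_neg (pow_pos (abs_pos.2 hs0) 2) ht
        rw [sq_abs] at this
        linarith
      · have h1 := hpos _ hw h0
        have h2 := mul_nonpos_of_nonneg_of_nonpos (sq_nonneg s) ht.le
        linarith
    · intro u v
      rw [hQ, hQ, hCsa, hCv u, hCv v, hPt', hPt']
      ring
    -- tr C² = tr A²: the remainder β ⊗ A²t has trace β(A²t) = 0, and A²P = (APAP)P because A kills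
    -- U; the trace is cyclic.
    · have h1 : A.comp A = (A.comp A).comp P + β.smulRight (A (A t)) := by
        ext v
        change A (A v) = A (A (P v)) + β v • A (A t)
        rw [← map_smul, ← map_add, ← hAP]
      have h2 : (A.comp A).comp P = (A.comp (P.comp (A.comp P))).comp P := by
        ext v
        change A (A (P v)) = A (P (A (P (P v))))
        rw [hAAP, hPP]
      have h3 : C.comp C = P.comp (A.comp (P.comp (A.comp P))) := by
        ext v
        change P (A (P (P (A (P v))))) = P (A (P (A (P v))))
        rw [hPP]
      rw [h3, traceL_comp_comm, ← h2]
      rw [h1, map_add, traceL_smulRight, hβA, add_zero] at htr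
      exact htr
  have hPAP : ∀ v, P (A (P v)) = 0 := fun v => congrArg (fun L : E →L[ℝ] E => L v) hC
  have hAPv : ∀ v, A (P v) = α (A (P v)) • U := fun v => by
    conv_lhs => rw [hAdec, hPAP, zero_add]
  refine ⟨?_, fun w hw => ⟨α (A (P w)), ?_⟩, fun h v => ⟨α (A v), ?_⟩⟩
  -- The two rank-one pieces have traces α(APU) = 0 and β(At) = 0.
  · have h1 : A = (α.comp (A.comp P)).smulRight U + β.smulRight (A t) := by
      ext v
      change A v = α (A (P v)) • U + β v • A t
      rw [← hAPv, ← hAP]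
    rw [h1, map_add, traceL_smulRight, traceL_smulRight, hβA, add_zero]
    change α (A (P U)) = 0
    rw [hPU, map_zero, map_zero]
  · rw [← hAPv]
    conv_lhs => rw [hAP, hβv, hs, hw, mul_zero, zero_smul, add_zero]
  -- This equals B(Av, Av) = B(v, A²v) = 0, and `B` is definite on the range of `P`.
  · have h1 : B (P (A v)) (P (A v)) = 0 := by
      rw [hPP', hPv, hβA, zero_smul, sub_zero, map_sub, sub_apply, map_smul, smul_apply, hAUv, hA, h]
      simp
    have h2 : P (A v) = 0 := by
      by_contra hne
      exact (hpos _ (hPt' _) hne).ne' h1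
    conv_lhs => rw [hAdec v, h2, zero_add]

end Coord

/-! ### Preferred charts and the passage to the manifold -/

namespace LorentzMetric

section Chart

variable {E : Type*} [NormedAddCommGroup E] [NormedSpace ℝ E]
  {M : Type*} [TopologicalSpace M] [ChartedSpace E M]

/-- The derivative of the inverse of the preferred chart, as an endomorphism of the model space. -/
def frame (p : M) (y : E) : E →L[ℝ] E :=
  mfderiv 𝓘(ℝ, E) 𝓘(ℝ, E) (extChartAt 𝓘(ℝ, E) p).symm y

variable [IsManifold 𝓘(ℝ, E) ∞ M]

theorem contMDiffAt_chart_symm {p : M} {y : E} (hy : y ∈ (extChartAt 𝓘(ℝ, E) p).target) :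
    ContMDiffAt 𝓘(ℝ, E) 𝓘(ℝ, E) ∞ (extChartAt 𝓘(ℝ, E) p).symm y :=
  (contMDiffOn_extChartAt_symm p).contMDiffAt ((isOpen_extChartAt_target p).mem_nhds hy)

theorem mdifferentiableAt_chart_symm {p : M} {y : E} (hy : y ∈ (extChartAt 𝓘(ℝ, E) p).target) :
    MDifferentiableAt 𝓘(ℝ, E) 𝓘(ℝ, E) (extChartAt 𝓘(ℝ, E) p).symm y :=
  (contMDiffAt_chart_symm hy).mdifferentiableAt (by simp)

theorem isInvertible_mfderiv_chart_symm {p : M} {y : E}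
    (hy : y ∈ (extChartAt 𝓘(ℝ, E) p).target) :
    (mfderiv 𝓘(ℝ, E) 𝓘(ℝ, E) (extChartAt 𝓘(ℝ, E) p).symm y).IsInvertible := by
  have : IsManifold 𝓘(ℝ, E) 1 M := IsManifold.of_le (n := ∞) (by simp)
  have h := isInvertible_mfderivWithin_extChartAt_symm (I := 𝓘(ℝ, E)) hy
  rwa [ModelWithCorners.range_eq_univ, mfderivWithin_univ] at h

theorem isInvertible_frame {p : M} {y : E} (hy : y ∈ (extChartAt 𝓘(ℝ, E) p).target) :
    (frame p y).IsInvertible := isInvertible_mfderiv_chart_symm hy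

/-- T_pM is identified with `E` through the preferred chart at `p`, so the derivative of the inverse
chart is the identity at the base point, though in general not elsewhere. -/
theorem frame_self (p : M) : frame p (extChartAt 𝓘(ℝ, E) p p) = ContinuousLinearMap.id ℝ E := by
  have hm := mem_extChartAt_target (I := 𝓘(ℝ, E)) p
  have h1 : frame p (extChartAt 𝓘(ℝ, E) p p) =
      fderiv ℝ (extChartAt 𝓘(ℝ, E) ((extChartAt 𝓘(ℝ, E) p).symm (extChartAt 𝓘(ℝ, E) p p)) ∘
        (extChartAt 𝓘(ℝ, E) p).symm) (extChartAt 𝓘(ℝ, E) p p) := by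
    refine Eq.trans (b := (fderivWithin ℝ (writtenInExtChartAt 𝓘(ℝ, E) 𝓘(ℝ, E)
      (extChartAt 𝓘(ℝ, E) p p) (extChartAt 𝓘(ℝ, E) p).symm) (Set.range 𝓘(ℝ, E))
      (extChartAt 𝓘(ℝ, E) p p) : E →L[ℝ] E)) (mdifferentiableAt_chart_symm hm).mfderiv ?_
    rw [ModelWithCorners.range_eq_univ, fderivWithin_univ]
    rfl
  rw [h1, extChartAt_to_inv]
  have h2 : extChartAt 𝓘(ℝ, E) p ∘ (extChartAt 𝓘(ℝ, E) p).symm =ᶠ[𝓝 (extChartAt 𝓘(ℝ, E) p p)]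
      id := by
    filter_upwards [(isOpen_extChartAt_target p).mem_nhds hm] with y hy
    exact (extChartAt 𝓘(ℝ, E) p).right_inv hy
  rw [h2.fderiv_eq, fderiv_id]

/-- The transition map between the preferred charts at `p` and `q`. -/
def transition (p q : M) (y : E) : E :=
  extChartAt 𝓘(ℝ, E) q ((extChartAt 𝓘(ℝ, E) p).symm y)

/-- The domain of the transition map. -/
def overlap (p q : M) : Set E :=
  (extChartAt 𝓘(ℝ, E) p).target ∩
    (extChartAt 𝓘(ℝ, E) p).symm ⁻¹' (extChartAt 𝓘(ℝ, E) q).source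

omit [IsManifold 𝓘(ℝ, E) ∞ M] in
theorem isOpen_overlap (p q : M) : IsOpen (overlap (E := E) p q) :=
  (continuousOn_extChartAt_symm p).isOpen_inter_preimage (isOpen_extChartAt_target p)
    (isOpen_extChartAt_source q)

theorem contDiffAt_transition {p q : M} {y : E} (hy : y ∈ overlap p q) :
    ContDiffAt ℝ ∞ (transition p q) y := by
  have h1 : ContMDiffAt 𝓘(ℝ, E) 𝓘(ℝ, E) ∞ (extChartAt 𝓘(ℝ, E) q)
      ((extChartAt 𝓘(ℝ, E) p).symm y) :=
    contMDiffAt_extChartAt' (by simpa using hy.2)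
  exact (h1.comp y (contMDiffAt_chart_symm hy.1)).contDiffAt

omit [IsManifold 𝓘(ℝ, E) ∞ M] in
theorem symm_transition {p q : M} {y : E} (hy : y ∈ overlap p q) :
    (extChartAt 𝓘(ℝ, E) q).symm (transition p q y) = (extChartAt 𝓘(ℝ, E) p).symm y :=
  (extChartAt 𝓘(ℝ, E) q).left_inv hy.2

omit [IsManifold 𝓘(ℝ, E) ∞ M] in
theorem transition_mem {p q : M} {y : E} (hy : y ∈ overlap p q) :
    transition p q y ∈ (extChartAt 𝓘(ℝ, E) q).target :=
  (extChartAt 𝓘(ℝ, E) q).map_source hy.2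

theorem frame_transition {p q : M} {y : E} (hy : y ∈ overlap p q) (u : E) :
    frame q (transition p q y) (fderiv ℝ (transition p q) y u) = frame p y u := by
  have h1 : (extChartAt 𝓘(ℝ, E) q).symm ∘ transition p q =ᶠ[𝓝 y] (extChartAt 𝓘(ℝ, E) p).symm := by
    filter_upwards [(isOpen_overlap p q).mem_nhds hy] with z hz using symm_transition hz
  have h2 := mfderiv_comp (I := 𝓘(ℝ, E)) (I' := 𝓘(ℝ, E)) (I'' := 𝓘(ℝ, E)) y
    (mdifferentiableAt_chart_symm (transition_mem hy))
    (contDiffAt_transition hy).differentiableAt_infty.mdifferentiableAt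
  rw [h1.mfderiv_eq, mfderiv_eq_fderiv] at h2
  exact (congrArg (fun L : E →L[ℝ] E => L u) h2).symm

/-- Smooth fields in the chart domain push forward to smooth fields on the manifold. -/
theorem contMDiffAt_frame_apply {p : M} {y : E} (hy : y ∈ (extChartAt 𝓘(ℝ, E) p).target)
    {W : E → E} (hW : ContDiffAt ℝ ∞ W y) :
    ContMDiffAt 𝓘(ℝ, E) (𝓘(ℝ, E).prod 𝓘(ℝ, E)) ∞
      (fun z => (⟨(extChartAt 𝓘(ℝ, E) p).symm z, frame p z (W z)⟩ : TangentBundle 𝓘(ℝ, E) M)) y := by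
  have ho := isOpen_extChartAt_target (I := 𝓘(ℝ, E)) p
  have h1 : ContMDiffAt 𝓘(ℝ, E) (𝓘(ℝ, E).prod 𝓘(ℝ, E)) ∞
      (fun z => (⟨z, W z⟩ : TangentBundle 𝓘(ℝ, E) E)) y :=
    contMDiffAt_vectorSpace_iff_contDiffAt.2 hW
  have h2 := (contMDiffOn_extChartAt_symm (I := 𝓘(ℝ, E)) (n := ∞) p).contMDiffOn_tangentMapWithin
    (m := ∞) (by norm_cast) ho.uniqueMDiffOn
  have h3 : ContMDiffAt (𝓘(ℝ, E).prod 𝓘(ℝ, E)) (𝓘(ℝ, E).prod 𝓘(ℝ, E)) ∞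
      (tangentMapWithin 𝓘(ℝ, E) 𝓘(ℝ, E) (extChartAt 𝓘(ℝ, E) p).symm (extChartAt 𝓘(ℝ, E) p).target)
      (⟨y, W y⟩ : TangentBundle 𝓘(ℝ, E) E) :=
    h2.contMDiffAt ((ho.preimage (FiberBundle.continuous_proj E _)).mem_nhds hy)
  refine (h3.comp y h1).congr_of_eventuallyEq ?_
  filter_upwards [ho.mem_nhds hy] with z hz
  simp only [Function.comp_apply, tangentMapWithin, mfderivWithin_of_isOpen ho hz]
  rfl

end Chart

variable {E : Type*} [NormedAddCommGroup E] [NormedSpace ℝ E]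
  {M : Type*} [TopologicalSpace M] [ChartedSpace E M] [IsManifold 𝓘(ℝ, E) ∞ M]
  (g : LorentzMetric E M)

/-- The scalar product at a point as a form on the model space. -/
def form (p : M) : E →L[ℝ] E →L[ℝ] ℝ := g.val p

theorem form_symm (p : M) (u v : E) : g.form p u v = g.form p v u := g.symm p u v

theorem form_lorentzian (p : M) : ∃ t : E, g.form p t t < 0 ∧
    ∀ v : E, g.form p t v = 0 → v ≠ 0 → 0 < g.form p v v := g.lorentzian p

theorem form_nondegenerate (p : M) (u : E) (hu : ∀ v, g.form p u v = 0) : u = 0 := by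
  obtain ⟨t, -, hpos⟩ := g.form_lorentzian p
  by_contra hne
  exact (hpos u (by rw [g.form_symm, hu]) hne).ne' (hu u)

theorem coord_apply (p : M) (y u v : E) :
    g.coord p y u v = g.form ((extChartAt 𝓘(ℝ, E) p).symm y) (frame p y u) (frame p y v) := rfl

theorem coord_self (p : M) : g.coord p (extChartAt 𝓘(ℝ, E) p p) = g.form p := by
  ext u v
  rw [coord_apply, frame_self, extChartAt_to_inv]
  rfl

variable [FiniteDimensional ℝ E]

theorem isInvertible_form (p : M) : (g.form p).IsInvertible :=
  Coord.isInvertible_of_nondegenerate (g.form_nondegenerate p)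

theorem form_inverse (p : M) (l : E →L[ℝ] ℝ) (v : E) :
    g.form p ((g.form p).inverse l) v = l v := by
  rw [(g.isInvertible_form p).self_apply_inverse]

omit [FiniteDimensional ℝ E] in
theorem contDiffOn_coord_apply (p : M) (u v : E) :
    ContDiffOn ℝ ∞ (fun y => g.coord p y u v) (extChartAt 𝓘(ℝ, E) p).target := by
  intro y hy
  have hφ := contMDiffAt_chart_symm hy
  have h1 : ContMDiffAt 𝓘(ℝ, E) (𝓘(ℝ, E).prod 𝓘(ℝ, ℝ)) ∞
      (fun z => Bundle.TotalSpace.mk' ℝ (E := Bundle.Trivial M ℝ) ((extChartAt 𝓘(ℝ, E) p).symm z)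
        (g.val ((extChartAt 𝓘(ℝ, E) p).symm z) (frame p z u) (frame p z v))) y := by
    apply ContMDiffAt.clm_bundle_apply₂ (F₁ := E) (F₂ := E)
    · exact (g.contMDiff.contMDiffAt).comp y hφ
    · exact contMDiffAt_frame_apply hy contDiffAt_const
    · exact contMDiffAt_frame_apply hy contDiffAt_const
  rw [Bundle.contMDiffAt_totalSpace] at h1
  exact h1.2.contDiffAt.contDiffWithinAt

theorem isMetricOn_coord (p : M) :
    Coord.IsMetricOn (g.coord p) (extChartAt 𝓘(ℝ, E) p).target where
  isOpen := isOpen_extChartAt_target p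
  smooth _ hy := Coord.contDiffAt_bilinear_of_apply (isOpen_extChartAt_target p)
    (g.contDiffOn_coord_apply p) hy
  symm y _ u v := g.form_symm _ _ _
  invertible y hy := by
    refine Coord.isInvertible_of_nondegenerate fun u hu => (isInvertible_frame hy).injective ?_
    rw [map_zero]
    refine g.form_nondegenerate ((extChartAt 𝓘(ℝ, E) p).symm y) _ fun w => ?_
    obtain ⟨w, rfl⟩ := (isInvertible_frame hy).surjective w
    exact hu w

/-- Both coordinate metrics express the same `g`, and by the chain rule the frames differ by the
derivative of the transition map. -/
theorem isPullback_transition (p q : M) :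
    Coord.IsPullback (transition p q) (g.coord q) (extChartAt 𝓘(ℝ, E) q).target (g.coord p)
      (overlap p q) where
  metric₀ := g.isMetricOn_coord q
  isOpen := isOpen_overlap p q
  smooth _ hy := contDiffAt_transition hy
  mapsTo _ hy := transition_mem hy
  invertible y hy := by
    have h1 : frame q (transition p q y) ∘L fderiv ℝ (transition p q) y = frame p y := by
      ext u; exact frame_transition hy u
    obtain ⟨e, he⟩ := isInvertible_frame (transition_mem hy)
    rw [← he] at h1
    have := isInvertible_frame hy.1
    rw [← h1] at this
    exact ContinuousLinearMap.isInvertible_equiv_comp.1 this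
  eq y hy u v := by
    rw [coord_apply, coord_apply, frame_transition hy, frame_transition hy, symm_transition hy]

variable {h : M → ℝ}

/-- The coordinate expression of a function in the preferred chart at `p`. -/
def coordFun (h : M → ℝ) (p : M) (y : E) : ℝ := h ((extChartAt 𝓘(ℝ, E) p).symm y)

omit [FiniteDimensional ℝ E] in
theorem contDiffAt_coordFun (hh : ContMDiff 𝓘(ℝ, E) 𝓘(ℝ, ℝ) ∞ h) {p : M} {y : E}
    (hy : y ∈ (extChartAt 𝓘(ℝ, E) p).target) : ContDiffAt ℝ ∞ (coordFun (E := E) h p) y :=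
  (hh.contMDiffAt.comp y (contMDiffAt_chart_symm hy)).contDiffAt

/-- The gradient as a vector of the model space. -/
def gradVec (h : M → ℝ) (p : M) : E := g.grad h p

theorem form_grad (h : M → ℝ) (p : M) (v : E) :
    g.form p (g.gradVec h p) v = (mfderiv 𝓘(ℝ, E) 𝓘(ℝ, ℝ) h p : E →L[ℝ] ℝ) v :=
  g.form_inverse p _ v

theorem frame_grad (hh : ContMDiff 𝓘(ℝ, E) 𝓘(ℝ, ℝ) ∞ h) {p : M} {y : E}
    (hy : y ∈ (extChartAt 𝓘(ℝ, E) p).target) :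
    frame p y (Coord.grad (g.coord p) (coordFun h p) y) =
      g.gradVec h ((extChartAt 𝓘(ℝ, E) p).symm y) := by
  rw [← sub_eq_zero]
  refine g.form_nondegenerate ((extChartAt 𝓘(ℝ, E) p).symm y) _ fun w => ?_
  obtain ⟨w, rfl⟩ := (isInvertible_frame hy).surjective w
  rw [map_sub, sub_apply, ← coord_apply, (g.isMetricOn_coord p).apply_grad hy, form_grad]
  have h2 := mfderiv_comp (I := 𝓘(ℝ, E)) (I' := 𝓘(ℝ, E)) (I'' := 𝓘(ℝ, ℝ)) y
    (hh.contMDiffAt.mdifferentiableAt (by simp)) (mdifferentiableAt_chart_symm hy)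
  refine sub_eq_zero.2 ?_
  have h3 : (mfderiv 𝓘(ℝ, E) 𝓘(ℝ, ℝ) (h ∘ (extChartAt 𝓘(ℝ, E) p).symm) y : E →L[ℝ] ℝ) =
      fderiv ℝ (coordFun h p) y := mfderiv_eq_fderiv
  exact (congrArg (fun L : E →L[ℝ] ℝ => L w) h3).symm.trans
    (congrArg (fun L : E →L[ℝ] ℝ => L w) h2)

theorem mpullback_grad (hh : ContMDiff 𝓘(ℝ, E) 𝓘(ℝ, ℝ) ∞ h) {p : M} {y : E}
    (hy : y ∈ (extChartAt 𝓘(ℝ, E) p).target) :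
    VectorField.mpullback 𝓘(ℝ, E) 𝓘(ℝ, E) (extChartAt 𝓘(ℝ, E) p).symm (g.grad h) y =
      Coord.grad (g.coord p) (coordFun h p) y := by
  exact (isInvertible_frame hy).inverse_apply_eq.2 (g.frame_grad hh hy).symm

/-- A covariant derivative depends only on the germ of the field, and on the chart domain the
pulled-back gradient is the coordinate gradient. -/
theorem nabla_grad (hh : ContMDiff 𝓘(ℝ, E) 𝓘(ℝ, ℝ) ∞ h) (p : M) :
    g.nabla (g.grad h) p =
      Coord.hessOp (g.coord p) (coordFun h p) (extChartAt 𝓘(ℝ, E) p p) := by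
  have hm := mem_extChartAt_target (I := 𝓘(ℝ, E)) p
  have h1 : (VectorField.mpullback 𝓘(ℝ, E) 𝓘(ℝ, E) (extChartAt 𝓘(ℝ, E) p).symm (g.grad h) : E → E)
      =ᶠ[𝓝 (extChartAt 𝓘(ℝ, E) p p)] Coord.grad (g.coord p) (coordFun h p) := by
    filter_upwards [(isOpen_extChartAt_target p).mem_nhds hm] with y hy
    exact g.mpullback_grad hh hy
  change Coord.covDeriv (g.coord p) _ _ = Coord.covDeriv (g.coord p) _ _
  unfold Coord.covDeriv
  rw [h1.fderiv_eq, h1.self_of_nhds]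

end LorentzMetric

/-! ### The Hessian and Ricci operators of an isotropic solution -/

namespace LorentzMetric

variable {E : Type*} [NormedAddCommGroup E] [NormedSpace ℝ E] [FiniteDimensional ℝ E]
  {M : Type*} [TopologicalSpace M] [ChartedSpace E M] [IsManifold 𝓘(ℝ, E) ∞ M]
  (g : LorentzMetric E M) {h : M → ℝ} {Λ : ℝ}

theorem smoothOn_grad (hh : ContMDiff 𝓘(ℝ, E) 𝓘(ℝ, ℝ) ∞ h) : SmoothOn (g.grad h) Set.univ := by
  intro p _
  refine ContMDiffAt.contMDiffWithinAt ?_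
  have hm := mem_extChartAt_target (I := 𝓘(ℝ, E)) p
  have h1 := contMDiffAt_frame_apply hm ((g.isMetricOn_coord p).contDiffAt_grad hm
    (contDiffAt_coordFun hh hm))
  have h2 : ContMDiffAt 𝓘(ℝ, E) 𝓘(ℝ, E) ∞ (extChartAt 𝓘(ℝ, E) p) p := contMDiffAt_extChartAt
  refine (h1.comp p h2).congr_of_eventuallyEq ?_
  filter_upwards [extChartAt_source_mem_nhds (I := 𝓘(ℝ, E)) p] with q hq
  simp only [Function.comp_apply]
  rw [g.frame_grad hh ((extChartAt 𝓘(ℝ, E) p).map_source hq),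
    (extChartAt 𝓘(ℝ, E) p).left_inv hq]
  rfl

/-- The Hessian operator as an endomorphism of the model space. -/
def hessOp (h : M → ℝ) (p : M) : E →L[ℝ] E := g.nabla (g.grad h) p

theorem hessOp_eq (hh : ContMDiff 𝓘(ℝ, E) 𝓘(ℝ, ℝ) ∞ h) (p : M) :
    g.hessOp h p = Coord.hessOp (g.coord p) (coordFun h p) (extChartAt 𝓘(ℝ, E) p p) :=
  g.nabla_grad hh p

/-- The Ricci operator as an endomorphism of the model space. -/
def ricOp (p : M) : E →L[ℝ] E := g.ricciOp p

theorem coord_grad_self (hh : ContMDiff 𝓘(ℝ, E) 𝓘(ℝ, ℝ) ∞ h) (p : M) :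
    Coord.grad (g.coord p) (coordFun h p) (extChartAt 𝓘(ℝ, E) p p) = g.gradVec h p := by
  have := g.frame_grad hh (mem_extChartAt_target (I := 𝓘(ℝ, E)) p)
  rwa [frame_self, extChartAt_to_inv] at this

theorem hessOp_symm (hh : ContMDiff 𝓘(ℝ, E) 𝓘(ℝ, ℝ) ∞ h) (p : M) (u v : E) :
    g.form p (g.hessOp h p u) v = g.form p u (g.hessOp h p v) := by
  have hm := mem_extChartAt_target (I := 𝓘(ℝ, E)) p
  rw [g.hessOp_eq hh, ← g.coord_self]
  exact (g.isMetricOn_coord p).hessOp_symm hm (contDiffAt_coordFun hh hm) u v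

omit [FiniteDimensional ℝ E] [IsManifold 𝓘(ℝ, E) ∞ M] in
theorem mem_overlap {p : M} {y : E} (hy : y ∈ (extChartAt 𝓘(ℝ, E) p).target) :
    y ∈ overlap (E := E) p ((extChartAt 𝓘(ℝ, E) p).symm y) :=
  ⟨hy, mem_extChartAt_source (I := 𝓘(ℝ, E)) _⟩

omit [FiniteDimensional ℝ E] [IsManifold 𝓘(ℝ, E) ∞ M] in
theorem coordFun_transition {p q : M} {y : E} (hy : y ∈ overlap p q) :
    coordFun h p y = coordFun h q (transition p q y) := by
  rw [coordFun, coordFun, symm_transition hy]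

theorem traceL_coord_hessOp (hh : ContMDiff 𝓘(ℝ, E) 𝓘(ℝ, ℝ) ∞ h) {p : M} {y : E}
    (hy : y ∈ (extChartAt 𝓘(ℝ, E) p).target) :
    Coord.traceL E (Coord.hessOp (g.coord p) (coordFun h p) y) =
      Coord.traceL E (g.hessOp h ((extChartAt 𝓘(ℝ, E) p).symm y)) := by
  set q := (extChartAt 𝓘(ℝ, E) p).symm y
  have hpb := g.isPullback_transition p q
  have hyo : y ∈ overlap (E := E) p q := mem_overlap hy
  rw [g.hessOp_eq hh]
  exact Coord.IsPullback.traceL_conj (hpb.invertible y hyo)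
    (hpb.hessOp (fun z hz => contDiffAt_coordFun hh hz) (fun z hz => coordFun_transition hz) hyo)

namespace IsIsotropicSolution

variable {g}

theorem einstein_apply (hs : g.IsIsotropicSolution h Λ) (p : M) (u v : E) :
    h p * Coord.ricci (g.coord p) (extChartAt 𝓘(ℝ, E) p p) u v - g.form p (g.hessOp h p u) v
      + (Coord.traceL E (g.hessOp h p) + Λ) * g.form p u v = 0 :=
  congrArg (fun B : E →L[ℝ] E →L[ℝ] ℝ => B u v) (hs.equation p)

/-- The hypothesis gives the equation at each point in that point's own chart. To differentiate it,
it is needed near the base point of one fixed chart, hence the transition maps. -/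
theorem einsteinAt (hs : g.IsIsotropicSolution h Λ) {p : M} {y : E}
    (hy : y ∈ (extChartAt 𝓘(ℝ, E) p).target) :
    Coord.EinsteinAt (g.coord p) (coordFun h p) Λ y := by
  set q := (extChartAt 𝓘(ℝ, E) p).symm y
  have hyo : y ∈ overlap (E := E) p q := mem_overlap hy
  refine (g.isPullback_transition p q).einsteinAt
    (fun z hz => contDiffAt_coordFun hs.smooth hz) (fun z hz => coordFun_transition hz) hyo ?_
  change Coord.EinsteinAt (g.coord q) (coordFun h q) Λ (extChartAt 𝓘(ℝ, E) q q)
  ext u v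
  have := hs.einstein_apply q u v
  rw [g.hessOp_eq hs.smooth, ← g.coord_self] at this
  simpa [coordFun] using this

theorem coord_grad_null (hs : g.IsIsotropicSolution h Λ) {p : M} {y : E}
    (hy : y ∈ (extChartAt 𝓘(ℝ, E) p).target) :
    g.coord p y (Coord.grad (g.coord p) (coordFun h p) y)
      (Coord.grad (g.coord p) (coordFun h p) y) = 0 := by
  rw [coord_apply, g.frame_grad hs.smooth hy]
  exact (hs.lightlike _).2

theorem hessOp_grad (hs : g.IsIsotropicSolution h Λ) (p : M) :
    g.hessOp h p (g.gradVec h p) = 0 := by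
  have hm := mem_extChartAt_target (I := 𝓘(ℝ, E)) p
  rw [g.hessOp_eq hs.smooth, ← g.coord_grad_self hs.smooth]
  refine (g.isMetricOn_coord p).hessOp_grad hm (contDiffAt_coordFun hs.smooth hm) ?_
  filter_upwards [(isOpen_extChartAt_target p).mem_nhds hm] with y hy using hs.coord_grad_null hy

theorem traceL_hessOp_sq (hs : g.IsIsotropicSolution h Λ) (hE : 2 ≤ Module.finrank ℝ E) (p : M) :
    Coord.traceL E ((g.hessOp h p).comp (g.hessOp h p)) = 0 ∧
      ((∀ q, Coord.traceL E (g.hessOp h q) = 0) → Λ = 0) := by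
  have hm := mem_extChartAt_target (I := 𝓘(ℝ, E)) p
  have hG := g.isMetricOn_coord p
  obtain ⟨h1, h2⟩ := hG.traceL_hessOp_sq hm hE
    (fun y hy => contDiffAt_coordFun hs.smooth hy)
    (by rw [coordFun]; exact (hs.pos _).ne') (fun y hy => hs.coord_grad_null hy)
    (fun y hy => hs.einsteinAt hy) (fun h0 => (hs.lightlike p).1 (by
      have h3 := g.coord_grad_self hs.smooth p
      rw [Coord.grad, h0, map_zero] at h3
      exact h3.symm))
  rw [g.hessOp_eq hs.smooth]
  refine ⟨h1, fun ht => h2 fun y hy => ?_⟩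
  rw [g.traceL_coord_hessOp hs.smooth hy, ht]

/-- Linear algebra of the Hessian operator of an isotropic solution. -/
theorem hessOp_spec (hs : g.IsIsotropicSolution h Λ) (hE : 2 ≤ Module.finrank ℝ E) (p : M) :
    Coord.traceL E (g.hessOp h p) = 0 ∧
      (∀ w, g.form p w (g.gradVec h p) = 0 → ∃ c : ℝ, g.hessOp h p w = c • g.gradVec h p) ∧
      ((∀ v, g.hessOp h p (g.hessOp h p v) = 0) →
        ∀ v, ∃ c : ℝ, g.hessOp h p v = c • g.gradVec h p) := by
  obtain ⟨t, ht, hpos⟩ := g.form_lorentzian p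
  exact Coord.lorentz_selfAdjoint (g.form_symm p) ht hpos (hs.lightlike p).1 (hs.lightlike p).2
    (g.hessOp_symm hs.smooth p) (hs.hessOp_grad p) (hs.traceL_hessOp_sq hE p).1

theorem traceL_hessOp (hs : g.IsIsotropicSolution h Λ) (hE : 2 ≤ Module.finrank ℝ E) (p : M) :
    Coord.traceL E (g.hessOp h p) = 0 := (hs.hessOp_spec hE p).1

/-- The image of A lies in U^⊥, since g(Av, U) = g(v, AU) = 0; A maps U^⊥ into ℝU and kills U. -/
theorem hessOp_cube (hs : g.IsIsotropicSolution h Λ) (hE : 2 ≤ Module.finrank ℝ E) (p : M)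
    (v : E) : g.hessOp h p (g.hessOp h p (g.hessOp h p v)) = 0 := by
  obtain ⟨c, hc⟩ := (hs.hessOp_spec hE p).2.1 (g.hessOp h p v) (by
    rw [g.hessOp_symm hs.smooth, hs.hessOp_grad, map_zero])
  rw [hc, map_smul, hs.hessOp_grad, smul_zero]

/-- Both tr A and Λ vanish, so h ρ = Hes_h is all that remains of the equation. -/
theorem smul_ricci (hs : g.IsIsotropicSolution h Λ) (hE : 2 ≤ Module.finrank ℝ E) (p : M)
    (u v : E) :
    h p * Coord.ricci (g.coord p) (extChartAt 𝓘(ℝ, E) p p) u v = g.form p (g.hessOp h p u) v := by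
  have h1 := hs.einstein_apply p u v
  rw [hs.traceL_hessOp hE p, (hs.traceL_hessOp_sq hE p).2 (hs.traceL_hessOp hE)] at h1
  linarith

theorem ricOp_eq (hs : g.IsIsotropicSolution h Λ) (hE : 2 ≤ Module.finrank ℝ E) (p : M) :
    g.ricOp p = (h p)⁻¹ • g.hessOp h p := by
  ext u
  rw [← sub_eq_zero]
  refine g.form_nondegenerate p _ fun v => ?_
  have h1 : g.form p (g.ricOp p u) v =
      Coord.ricci (g.coord p) (extChartAt 𝓘(ℝ, E) p p) u v := g.form_inverse p _ v
  rw [map_sub, sub_apply, h1, smul_apply, map_smul, smul_apply, ← hs.smul_ricci hE, smul_eq_mul,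
    inv_mul_cancel_left₀ (hs.pos p).ne', sub_self]

theorem ricci_eq_zero (hs : g.IsIsotropicSolution h Λ) (hE : 2 ≤ Module.finrank ℝ E) {p : M}
    (hp : g.hessOp h p = 0) : g.ricci p = 0 := by
  have h1 : Coord.ricci (g.coord p) (extChartAt 𝓘(ℝ, E) p p) = 0 := by
    ext u v
    have h2 := hs.smul_ricci hE p u v
    rw [hp] at h2
    simpa [(hs.pos p).ne'] using h2
  exact h1

theorem ricciOp_sq (hs : g.IsIsotropicSolution h Λ) (hE : 2 ≤ Module.finrank ℝ E) (p : M) :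
    g.ricciOp p ^ 2 = 0 ↔ ∀ v, g.hessOp h p (g.hessOp h p v) = 0 := by
  have h1 : g.ricOp p ^ 2 = 0 ↔ ∀ v, g.hessOp h p (g.hessOp h p v) = 0 := by
    rw [hs.ricOp_eq hE, smul_pow, smul_eq_zero_iff_right (pow_ne_zero _ (inv_ne_zero
      (hs.pos p).ne')), ContinuousLinearMap.ext_iff]
    rfl
  exact h1

theorem ricciOp_cube (hs : g.IsIsotropicSolution h Λ) (hE : 2 ≤ Module.finrank ℝ E) (p : M) :
    g.ricciOp p ^ 3 = 0 := by
  have h1 : g.ricOp p ^ 3 = 0 := by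
    rw [hs.ricOp_eq hE, smul_pow]
    ext v
    change (h p)⁻¹ ^ 3 • g.hessOp h p (g.hessOp h p (g.hessOp h p v)) = 0
    rw [hs.hessOp_cube hE, smul_zero]
  exact h1

theorem ricciOp_ne_zero (hs : g.IsIsotropicSolution h Λ) (hE : 2 ≤ Module.finrank ℝ E) {p : M}
    (hp : g.hessOp h p ≠ 0) : g.ricciOp p ≠ 0 := by
  have h1 : g.ricOp p ≠ 0 := by
    rw [hs.ricOp_eq hE]
    exact smul_ne_zero (inv_ne_zero (hs.pos p).ne') hp
  exact h1

theorem isBrinkmannWave (hs : g.IsIsotropicSolution h Λ) (hE : 2 ≤ Module.finrank ℝ E)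
    (hsq : ∀ p v, g.hessOp h p (g.hessOp h p v) = 0) : g.IsBrinkmannWave := by
  refine ⟨fun q => Submodule.span ℝ {g.grad h q}, fun p => ⟨Set.univ, isOpen_univ, trivial,
    g.grad h, g.smoothOn_grad hs.smooth, fun q _ => ⟨hs.lightlike q, rfl, fun u => ?_⟩⟩⟩
  obtain ⟨c, hc⟩ := (hs.hessOp_spec hE q).2.2 (hsq q) u
  exact Submodule.mem_span_singleton.2 ⟨c, hc.symm⟩

theorem adjoint_nabla_grad (hs : g.IsIsotropicSolution h Λ) (p : M) :
    g.adjoint p (g.nabla (g.grad h) p) = ↑(g.nabla (g.grad h) p) := by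
  ext u
  have h1 : (g.form p).inverse ((g.form p u).comp (g.hessOp h p)) = g.hessOp h p u := by
    rw [(g.isInvertible_form p).inverse_apply_eq]
    ext v
    exact (g.hessOp_symm hs.smooth p u v).symm
  exact h1

/-- For V = U one has ∇V = A = A*, so the twist is zero, σ² reduces to tr A² once tr A = 0, and the
geodesic condition is AU = 0. -/
theorem isKundtField_grad (hs : g.IsIsotropicSolution h Λ) (hE : 2 ≤ Module.finrank ℝ E) :
    g.IsKundtField (g.grad h) := by
  have hdiv : ∀ p, g.div (g.grad h) p = 0 := hs.traceL_hessOp hE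
  have hexp : ∀ p, g.expansion (g.grad h) p = 0 := fun p => by
    rw [expansion, hdiv, mul_zero]
  have hcon : ∀ p, g.contract p (g.nabla (g.grad h) p) ↑(g.nabla (g.grad h) p) = 0 := fun p => by
    rw [contract, hs.adjoint_nabla_grad]
    exact (hs.traceL_hessOp_sq hE p).1
  refine ⟨g.smoothOn_grad hs.smooth, hs.lightlike, hs.hessOp_grad, hexp, fun p => ?_, fun p => ?_⟩
  · rw [shearSq, hs.adjoint_nabla_grad, hexp, ← two_smul ℝ, smul_smul]
    norm_num
    exact hcon p
  · rw [twistSq, hs.adjoint_nabla_grad, sub_self, smul_zero, contract, LinearMap.comp_zero,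
      map_zero]

end IsIsotropicSolution

end LorentzMetric

end

/-! ### The trichotomy -/

theorem theorem1p2
    {E : Type*} [NormedAddCommGroup E] [NormedSpace ℝ E] [FiniteDimensional ℝ E]
    (hn : 3 ≤ Module.finrank ℝ E)
    {M : Type*} [TopologicalSpace M] [ChartedSpace E M] [IsManifold 𝓘(ℝ, E) ∞ M]
    (g : LorentzMetric E M) (h : M → ℝ) (Λ : ℝ) (hsol : g.IsIsotropicSolution h Λ) :
    ((∀ p, g.ricci p = 0) ∧ (∀ p, g.hess h p = 0)) ∨
    (g.RicciStepNilpotent 2 ∧ g.IsBrinkmannWave) ∨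
    (g.RicciStepNilpotent 3 ∧ g.IsKundt ∧ g.IsKundtField (g.grad h)) := by
  have hE : 2 ≤ Module.finrank ℝ E := by omega
  by_cases h1 : ∀ p, g.hessOp h p = 0
  · refine Or.inl ⟨fun p => hsol.ricci_eq_zero hE (h1 p), fun p => ?_⟩
    have h2 : (g.form p).comp (g.hessOp h p) = 0 := by
      rw [h1, ContinuousLinearMap.comp_zero]
    exact h2
  · push Not at h1
    obtain ⟨p, hp⟩ := h1
    -- The nilpotency step is that of the whole field, so the case distinction is global: one point
    -- with A² ≠ 0 gives step 3.
    by_cases h2 : ∀ p v, g.hessOp h p (g.hessOp h p v) = 0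
    · refine Or.inr (Or.inl ⟨⟨fun p => (hsol.ricciOp_sq hE p).2 (h2 p), p, ?_⟩,
        hsol.isBrinkmannWave hE h2⟩)
      rw [Nat.add_one_sub_one, pow_one]
      exact hsol.ricciOp_ne_zero hE hp
    · rw [not_forall] at h2
      obtain ⟨p, hp⟩ := h2
      have hK := hsol.isKundtField_grad hE
      exact Or.inr (Or.inr ⟨⟨hsol.ricciOp_cube hE, p, fun h0 => hp ((hsol.ricciOp_sq hE p).1 h0)⟩,
        ⟨_, hK⟩, hK⟩)
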